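/- Let $(M,g)$ be a compact smooth Riemannian manifold of dimension at least $1$, with (possibly empty) boundary. Let $G$ be a finite group acting on $M$ by isometries, and let $H,H'\le G$ be almost conjugate subgroups, that is, every element of $G$ has equally many conjugates in $H$ and in $H'$; assume that the restrictions of the action to $H$ and to $H'$ are free. Let $\rho\in L^\infty(\partial M)$ be nonnegative and $G$-invariant. Assume moreover that there is an isometry $\tau$ of $(M,g)$ that is not given by an element of $G$ and satisfies $\tau H\tau^{-1}=H'$, as groups of isometries of $M$. Then the function $\tau^*\rho=\rho\circ\tau$ on $\partial M$ is $H$-invariant; denote again by $g$, $\rho$ and $\tau^*\rho$ the metric on $H\backslash M$ and the functions on $\partial(H\backslash M)$ induced by $g$, $\rho$ and $\tau^*\rho$. For every $\alpha\in\mathbb{R}$ that is not in the Dirichlet spectrum of $(H\backslash M,g)$, $$\operatorname{Stek}_\alpha(H\backslash M,g,\rho)=\operatorname{Stek}_\alpha(H\backslash M,g,\tau^*\rho),$$ as sets and with multiplicities. Here, for a compact Riemannian manifold $(N,g)$ with boundary and $\varrho\in L^\infty(\partial N)$, $\operatorname{Stek}_\alpha(N,g,\varrho)$ is the collection of the real numbers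 $\sigma$ for which the problem $\Delta u=\alpha u$ in $N\smallsetminus\partial N$, $\partial_\nu u=\sigma\varrho u$ on $\partial N$, has a nontrivial solution $u\in H^1(N)$, and the multiplicity of $\sigma$ is the dimension of the space of solutions. The problem is understood weakly, with $u|_{\partial N}$ the Sobolev trace: $$\int_N\langle\nabla u,\nabla\psi\rangle\,dvol=\alpha\int_N u\psi\,dvol+\sigma\int_{\partial N}\varrho\,u\,\psi\,dvol_{\partial N}\qquad\text{for all }\psi\in C^\infty(N).$$ -/

import Mathlib

open Set Filter Topology MeasureTheory MulAction
open scoped Manifold ContDiff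

noncomputable section

namespace Steklov

/-! ### The quotient of a Riemannian manifold by a free isometric action of a finite group -/

/-- Each element of `G` acts on `M` by a smooth map. -/
class ContMDiffConstSMul {E : Type*} [NormedAddCommGroup E] [NormedSpace ℝ E] {H : Type*}
    [TopologicalSpace H] (I : ModelWithCorners ℝ E H) (G M : Type*) [TopologicalSpace M]
    [ChartedSpace H M] [SMul G M] : Prop where
  contMDiff_const_smul : ∀ a : G, ContMDiff I I ∞ (fun x : M => a • x)

set_option linter.unusedSectionVars false
section Quotient

variable {E : Type*} [NormedAddCommGroup E] [NormedSpace ℝ E] {H : Type*}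
  [TopologicalSpace H] {I : ModelWithCorners ℝ E H} {G M : Type*} [TopologicalSpace M]
  [ChartedSpace H M] [IsManifold I ∞ M] [T2Space M] [LocallyCompactSpace M]
  [Group G] [MulAction G M] [ContinuousConstSMul G M] [ProperlyDiscontinuousSMul G M]
  [IsCancelSMul G M] [ContMDiffConstSMul I G M]

variable (G M) in
/-- The projection `M → G \ M`. -/
def quotProj : M → orbitRel.Quotient G M := Quotient.mk (orbitRel G M)

theorem quotProj_isLocalHomeomorph : IsLocalHomeomorph (quotProj G M) :=
  isQuotientCoveringMap_quotientMk_of_properlyDiscontinuousSMul.isCoveringMap.isLocalHomeomorph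

theorem quotProj_eq_iff {x y : M} : quotProj G M x = quotProj G M y ↔ ∃ a : G, a • y = x := by
  unfold quotProj
  rw [Quotient.eq]; rfl

variable (G) in
/-- A local inverse of the projection `M → G \ M`, sending the orbit of `x` to `x`. -/
def quotSection (x : M) : OpenPartialHomeomorph (orbitRel.Quotient G M) M :=
  (quotProj_isLocalHomeomorph (G := G)).localInverseAt x

theorem quotProj_quotSection {x : M} {q} (hq : q ∈ (quotSection G x).source) :
    quotProj G M (quotSection G x q) = q :=
  (quotProj_isLocalHomeomorph (G := G)).apply_localInverseAt_of_mem hq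

theorem quotSection_quotProj {x z : M} (hz : z ∈ (quotSection G x).target) :
    quotSection G x (quotProj G M z) = z := by
  have h := (quotSection G x).right_inv hz
  rwa [quotSection, (quotProj_isLocalHomeomorph (G := G)).localInverseAt_symm] at h

theorem contMDiffAt_quotSection_quotProj {y u : M}
    (hu : quotProj G M u ∈ (quotSection G y).source) :
    ContMDiffAt I I ∞ (fun z => quotSection G y (quotProj G M z)) u := by
  obtain ⟨a, ha⟩ := quotProj_eq_iff.1 (quotProj_quotSection hu)
  have h1 : ∀ᶠ z in 𝓝 u, a • z ∈ (quotSection G y).target := by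
    apply (continuous_const_smul a).continuousAt.eventually_mem
    rw [ha]
    exact (quotSection G y).open_target.mem_nhds ((quotSection G y).map_source hu)
  refine ((ContMDiffConstSMul.contMDiff_const_smul (I := I) a).contMDiffAt).congr_of_eventuallyEq ?_
  filter_upwards [h1] with z hz
  rw [← quotSection_quotProj hz]
  congr 1
  exact quotProj_eq_iff.2 ⟨a⁻¹, by simp⟩

theorem atlas_quotient {e : OpenPartialHomeomorph (orbitRel.Quotient G M) H}
    (he : e ∈ atlas H (orbitRel.Quotient G M)) :
    ∃ x : M, e = (quotSection G x).trans (chartAt H x) := by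
  obtain ⟨q, rfl⟩ := he
  exact ⟨_, rfl⟩

theorem chartAt_quotient (q : orbitRel.Quotient G M) :
    ∃ x : M, quotProj G M x = q ∧ chartAt H q = (quotSection G x).trans (chartAt H x) :=
  ⟨_, (Quotient.mk_surjective (s := orbitRel G M)).hasRightInverse.choose_spec q, rfl⟩

/-- The quotient, with the charted space structure that Mathlib puts on it (charts are charts of
`M` composed with local inverses of the projection), is a smooth manifold. -/
instance instIsManifoldQuotient : IsManifold I ∞ (orbitRel.Quotient G M) := by
  apply isManifold_of_contDiffOn
  intro e e' he he'
  obtain ⟨x, rfl⟩ := atlas_quotient he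
  obtain ⟨y, rfl⟩ := atlas_quotient he'
  have key : ContMDiffOn I I ∞ (fun p => chartAt H y (quotSection G y (quotProj G M
      ((chartAt H x).symm p)))) ((((quotSection G x).trans (chartAt H x)).symm.trans
        ((quotSection G y).trans (chartAt H y))).source) := by
    intro p hp
    have hs : ∀ z, (quotSection G x).symm z = quotProj G M z := fun z => by
      rw [quotSection, (quotProj_isLocalHomeomorph (G := G)).localInverseAt_symm]
    simp only [OpenPartialHomeomorph.trans_source, OpenPartialHomeomorph.symm_source,
      OpenPartialHomeomorph.trans_target, mem_inter_iff, mem_preimage,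
      OpenPartialHomeomorph.coe_trans_symm, Function.comp_apply, hs] at hp
    have h1 : ContMDiffAt I I ∞ (chartAt H x).symm p :=
      (contMDiffOn_chart_symm p hp.1.1).contMDiffAt ((chartAt H x).open_target.mem_nhds hp.1.1)
    have h2 := contMDiffAt_quotSection_quotProj (I := I) hp.2.1
    have h3 : ContMDiffAt I I ∞ (chartAt H y)
        (quotSection G y (quotProj G M ((chartAt H x).symm p))) :=
      (contMDiffOn_chart _ hp.2.2).contMDiffAt ((chartAt H y).open_source.mem_nhds hp.2.2)
    exact ((h3.comp p (h2.comp p h1))).contMDiffWithinAt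
  have hs : ∀ z, (quotSection G x).symm z = quotProj G M z := fun z => by
      rw [quotSection, (quotProj_isLocalHomeomorph (G := G)).localInverseAt_symm]
  intro p hp
  have := key _ hp.1
  rw [contMDiffWithinAt_iff] at this
  have h4 := this.2
  obtain ⟨hp1, p', rfl⟩ := hp
  have h5 : ∀ z, (I ∘ ((quotSection G x ≫ₕ chartAt H x).symm ≫ₕ
      quotSection G y ≫ₕ chartAt H y) ∘ I.symm) z =
      I (chartAt H y (quotSection G y (quotProj G M ((chartAt H x).symm (I.symm z))))) := by
    intro z
    simp only [OpenPartialHomeomorph.coe_trans, OpenPartialHomeomorph.coe_trans_symm,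
      Function.comp_apply, hs]
  have h6 : extChartAt I (I.symm (I p')) (I.symm (I p')) = I p' := by
    simp [extChartAt, chartAt_self_eq]
  rw [h6] at h4
  refine ContDiffWithinAt.congr (h4.mono fun z hz => hz) (fun z _ => h5 z) (h5 _)

theorem contMDiff_quotProj : ContMDiff I I ∞ (quotProj G M) := by
  intro u
  obtain ⟨x, hx, hc⟩ := chartAt_quotient (H := H) (quotProj G M u)
  have hs : quotProj G M u ∈ (quotSection G x).source := by
    rw [← hx]; exact (quotProj_isLocalHomeomorph (G := G)).apply_self_mem_localInverseAt_source
  have hxx : quotSection G x (quotProj G M u) = x := by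
    rw [← hx]; exact (quotProj_isLocalHomeomorph (G := G)).localInverseAt_apply_self
  rw [contMDiffAt_iff_target]
  refine ⟨(quotProj_isLocalHomeomorph (G := G)).continuous.continuousAt, ?_⟩
  have h2 := contMDiffAt_quotSection_quotProj (I := I) hs
  have h3 : ContMDiffAt I 𝓘(ℝ, E) ∞ (extChartAt I x) (quotSection G x (quotProj G M u)) := by
    rw [hxx]; exact contMDiffAt_extChartAt
  have h4 := h3.comp u h2
  convert h4 using 1
  simp only [extChartAt, hc]
  rfl

theorem contMDiffOn_quotSection (x : M) :
    ContMDiffOn I I ∞ (quotSection G x) (quotSection G x).source := by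
  intro q hq
  obtain ⟨y, hy, hc⟩ := chartAt_quotient (H := H) q
  have hs : q ∈ (quotSection G y).source := by
    rw [← hy]; exact (quotProj_isLocalHomeomorph (G := G)).apply_self_mem_localInverseAt_source
  have hyy : quotSection G y q = y := by
    rw [← hy]; exact (quotProj_isLocalHomeomorph (G := G)).localInverseAt_apply_self
  have h1 : ContMDiffAt I I ∞ (chartAt H q) q :=
    (contMDiffOn_chart _ (mem_chart_source H q)).contMDiffAt (chart_source_mem_nhds H q)
  have hq1 : chartAt H q q ∈ (chartAt H y).target := by
    rw [hc]
    simp only [OpenPartialHomeomorph.coe_trans, Function.comp_apply, hyy]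
    exact mem_chart_target H y
  have h2 : ContMDiffAt I I ∞ (chartAt H y).symm (chartAt H q q) :=
    (contMDiffOn_chart_symm _ hq1).contMDiffAt ((chartAt H y).open_target.mem_nhds hq1)
  have h3 : ContMDiffAt I I ∞ (quotSection G y) q := by
    refine (h2.comp q h1).congr_of_eventuallyEq ?_
    filter_upwards [chart_source_mem_nhds H q] with z hz
    rw [hc] at hz
    simp only [hc, Function.comp_apply, OpenPartialHomeomorph.coe_trans]
    exact ((chartAt H y).left_inv hz.2).symm
  have h4 : ContMDiffAt I I ∞ (fun z => quotSection G x (quotProj G M z)) (quotSection G y q) :=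
    contMDiffAt_quotSection_quotProj (by rwa [quotProj_quotSection hs])
  refine ((h4.comp q h3).congr_of_eventuallyEq ?_).contMDiffWithinAt
  filter_upwards [(quotSection G y).open_source.mem_nhds hs] with z hz
  simp only [Function.comp_apply, quotProj_quotSection hz]


/-- Smooth Riemannian metrics on the manifold `N`. -/
abbrev RiemannianMetricOn (I : ModelWithCorners ℝ E H) (N : Type*) [TopologicalSpace N] [ChartedSpace H N]
    [IsManifold I ∞ N] :=
  Bundle.ContMDiffRiemannianMetric I ∞ E (fun x : N => TangentSpace I x)

/-- `f` pulls the metric `g` back to `g`. -/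
def PreservesMetric {N : Type*} [TopologicalSpace N] [ChartedSpace H N] [IsManifold I ∞ N]
    (g : RiemannianMetricOn I N) (f : N → N) : Prop :=
  ∀ (x : N) (v w : TangentSpace I x),
    g.inner (f x) (mfderiv I I f x v) (mfderiv I I f x w) = g.inner x v w

/-- The pullback of `g` under the local inverse of the projection at `x`. -/
def sectionInner (g : RiemannianMetricOn I M) (x : M) (q : orbitRel.Quotient G M) :
    TangentSpace I q →L[ℝ] TangentSpace I q →L[ℝ] ℝ :=
  (ContinuousLinearMap.precomp ℝ (mfderiv I I (quotSection G x) q)).comp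
    ((g.inner (quotSection G x q)).comp (mfderiv I I (quotSection G x) q))

theorem sectionInner_apply (g : RiemannianMetricOn I M) (x : M) (q : orbitRel.Quotient G M)
    (v w : TangentSpace I q) :
    sectionInner g x q v w = g.inner (quotSection G x q) (mfderiv I I (quotSection G x) q v)
      (mfderiv I I (quotSection G x) q w) := rfl

theorem contMDiffAt_quotSection {x : M} {q} (hq : q ∈ (quotSection G x).source) :
    ContMDiffAt I I ∞ (quotSection G x) q :=
  (contMDiffOn_quotSection x q hq).contMDiffAt ((quotSection G x).open_source.mem_nhds hq)

theorem mem_quotSection_source (x : M) : quotProj G M x ∈ (quotSection G x).source :=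
  (quotProj_isLocalHomeomorph (G := G)).apply_self_mem_localInverseAt_source

theorem quotProj_out (q : orbitRel.Quotient G M) : quotProj G M q.out = q := Quotient.out_eq _

theorem mem_quotSection_out (q : orbitRel.Quotient G M) : q ∈ (quotSection G q.out).source := by
  have h := mem_quotSection_source (G := G) q.out
  rwa [quotProj_out] at h

theorem sectionInner_congr {g : RiemannianMetricOn I M} (hg : ∀ a : G, PreservesMetric g (fun x => a • x))
    {x y : M} {q : orbitRel.Quotient G M} (hx : q ∈ (quotSection G x).source)
    (hy : q ∈ (quotSection G y).source) : sectionInner g x q = sectionInner g y q := by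
  obtain ⟨a, ha⟩ := quotProj_eq_iff.1
    ((quotProj_quotSection hy).trans (quotProj_quotSection hx).symm)
  have h1 : quotSection G y =ᶠ[𝓝 q] fun z => a • quotSection G x z := by
    have hc : ContinuousAt (fun z => a • quotSection G x z) q :=
      ((quotSection G x).continuousAt hx).const_smul a
    have : ∀ᶠ z in 𝓝 q, a • quotSection G x z ∈ (quotSection G y).target := by
      apply hc.eventually_mem
      rw [ha]
      exact (quotSection G y).open_target.mem_nhds ((quotSection G y).map_source hy)
    filter_upwards [this, (quotSection G x).open_source.mem_nhds hx] with z hz hzx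
    rw [← quotSection_quotProj hz]
    congr 1
    rw [← quotProj_quotSection hzx]
    exact quotProj_eq_iff.2 ⟨a⁻¹, by simp [quotProj_quotSection hzx]⟩
  have h2 : mfderiv I I (quotSection G y) q = (mfderiv I I (fun z => a • z) (quotSection G x q)).comp
      (mfderiv I I (quotSection G x) q) := by
    rw [← mfderiv_comp q ((ContMDiffConstSMul.contMDiff_const_smul (I := I) a).mdifferentiable
      (by simp) _) ((contMDiffAt_quotSection hx).mdifferentiableAt (by simp))]
    exact h1.mfderiv_eq
  ext v w
  rw [sectionInner_apply, sectionInner_apply, ← hg a]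
  have key : ∀ (p p' : M) (_ : p' = p) (A A' : E →L[ℝ] E) (_ : A' = A),
      (g.inner p : E →L[ℝ] E →L[ℝ] ℝ) (A v) (A w) =
      (g.inner p' : E →L[ℝ] E →L[ℝ] ℝ) (A' v) (A' w) := by
    rintro p _ rfl A _ rfl
    rfl
  exact key _ _ ha.symm _ _ h2

theorem mfderiv_quotProj_comp {x : M} {q : orbitRel.Quotient G M} (hq : q ∈ (quotSection G x).source)
    (v : TangentSpace I q) :
    mfderiv I I (quotProj G M) (quotSection G x q) (mfderiv I I (quotSection G x) q v) = v := by
  have h1 : (fun z => quotProj G M (quotSection G x z)) =ᶠ[𝓝 q] id := by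
    filter_upwards [(quotSection G x).open_source.mem_nhds hq] with z hz
    exact quotProj_quotSection hz
  have h2 := h1.mfderiv_eq (I := I) (I' := I)
  have h3 := mfderiv_comp q ((contMDiff_quotProj (G := G) (M := M) (I := I)).mdifferentiable
    (by simp) _)
    ((contMDiffAt_quotSection hq).mdifferentiableAt (I := I) (by simp))
  have h4 : (mfderiv I I (quotProj G M) (quotSection G x q)).comp (mfderiv I I (quotSection G x) q)
    = ContinuousLinearMap.id ℝ (TangentSpace I q) := by
    rw [← h3, ← mfderiv_id]
    exact h2
  exact congrArg (fun L : E →L[ℝ] E => L v) h4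

theorem mfderiv_quotSection_comp {x : M} (v : TangentSpace I x) :
    mfderiv I I (quotSection G x) (quotProj G M x) (mfderiv I I (quotProj G M) x v) = v := by
  have ht : x ∈ (quotSection G x).target :=
    (quotProj_isLocalHomeomorph (G := G)).self_mem_localInverseAt_target
  have h1 : (fun z => quotSection G x (quotProj G M z)) =ᶠ[𝓝 x] id := by
    filter_upwards [(quotSection G x).open_target.mem_nhds ht] with z hz
    exact quotSection_quotProj hz
  have h2 := h1.mfderiv_eq (I := I) (I' := I)
  have h3 := mfderiv_comp x ((contMDiffAt_quotSection (mem_quotSection_source (G := G) x)).mdifferentiableAt (I := I) (by simp))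
    ((contMDiff_quotProj (G := G) (M := M) (I := I)).mdifferentiable (by simp) x)
  have h4 : (mfderiv I I (quotSection G x) (quotProj G M x)).comp (mfderiv I I (quotProj G M) x)
    = ContinuousLinearMap.id ℝ (TangentSpace I x) := by
    rw [← mfderiv_id]
    exact h3.symm.trans h2
  exact congrArg (fun L : E →L[ℝ] E => L v) h4

theorem contMDiffAt_clm_of_apply [FiniteDimensional ℝ E] {N : Type*} [TopologicalSpace N]
    [ChartedSpace H N] {F : Type*} [NormedAddCommGroup F] [NormedSpace ℝ F]
    {f : N → E →L[ℝ] F} {q : N} (h : ∀ v, ContMDiffAt I 𝓘(ℝ, F) ∞ (fun z => f z v) q) :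
    ContMDiffAt I 𝓘(ℝ, E →L[ℝ] F) ∞ f q := by
  let d := Module.finrank ℝ E
  have hd : d = Module.finrank ℝ (Fin d → ℝ) := (Module.finrank_fin_fun ℝ).symm
  let e₁ := ContinuousLinearEquiv.ofFinrankEq hd
  let e₂ := (e₁.arrowCongr (1 : F ≃L[ℝ] F)).trans (ContinuousLinearEquiv.piRing (Fin d))
  rw [← Function.id_comp f, ← e₂.symm_comp_self]
  exact e₂.symm.contDiff.contMDiff.contMDiffAt.comp q (contMDiffAt_pi_space.mpr fun i => h _)

theorem contMDiffAt_sectionInner [FiniteDimensional ℝ E] (g : RiemannianMetricOn I M) {x : M}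
    {q : orbitRel.Quotient G M} (hq : q ∈ (quotSection G x).source) :
    ContMDiffAt I (I.prod 𝓘(ℝ, E →L[ℝ] E →L[ℝ] ℝ)) ∞
      (fun z => Bundle.TotalSpace.mk' (E →L[ℝ] E →L[ℝ] ℝ)
        (E := fun z : orbitRel.Quotient G M => TangentSpace I z →L[ℝ] TangentSpace I z →L[ℝ] ℝ)
        z (sectionInner g x z)) q := by
  rw [contMDiffAt_hom_bundle]
  refine ⟨contMDiffAt_id, ?_⟩
  refine contMDiffAt_clm_of_apply fun v => contMDiffAt_clm_of_apply fun w => ?_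
  let e := trivializationAt E (TangentSpace I) q
  have hsec : ∀ v : E, ContMDiffAt I I.tangent ∞
      (fun z => Bundle.TotalSpace.mk' E (E := (TangentSpace I : M → Type _)) (quotSection G x z)
        (mfderiv I I (quotSection G x) z (e.symm z v))) q := by
    intro v
    have h1 : ContMDiffAt I I.tangent ∞ (fun z => Bundle.TotalSpace.mk' E
        (E := (TangentSpace I : orbitRel.Quotient G M → Type _)) z (e.symm z v)) q := by
      have h2 := ContMDiffAt.clm_bundle_apply (F₁ := E) (F₂ := E) (v := fun _ => v)
        (E₁ := fun _ : orbitRel.Quotient G M => E)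
        (E₂ := (TangentSpace I : orbitRel.Quotient G M → Type _))
        (e.contMDiffAt_symmL (IB := I) (n := ∞) (FiberBundle.mem_baseSet_trivializationAt' q))
        (by
          rw [Bundle.contMDiffAt_section]
          exact contMDiffAt_const)
      refine h2.congr_of_eventuallyEq ?_
      filter_upwards [e.open_baseSet.mem_nhds (FiberBundle.mem_baseSet_trivializationAt' q)] with
        z hz
      rw [e.symmL_apply hz]
    exact ContMDiffAt.clm_apply_of_inCoordinates (b₁ := fun z => z)
      (E₁ := (TangentSpace I : orbitRel.Quotient G M → Type _))
      (E₂ := (TangentSpace I : M → Type _))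
      ((contMDiffAt_quotSection hq).mfderiv_const (by simp)) h1 (contMDiffAt_quotSection hq)
  have h := ContMDiffAt.clm_bundle_apply₂ (F₁ := E) (F₂ := E) (F₃ := ℝ)
    (E₃ := fun _ : M => ℝ) (g.contMDiff.contMDiffAt.comp q (contMDiffAt_quotSection hq)) (hsec v) (hsec w)
  rw [Bundle.contMDiffAt_totalSpace] at h
  refine h.2.congr_of_eventuallyEq ?_
  have hb := e.open_baseSet.mem_nhds (FiberBundle.mem_baseSet_trivializationAt' q)
  filter_upwards [hb] with z hz
  rw [inCoordinates_apply_eq₂ hz hz (by simp)]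
  simp [sectionInner_apply]
  rfl

/-- The Riemannian metric induced on `G \ M` by a `G`-invariant metric `g` on `M`. -/
def quotientMetric [FiniteDimensional ℝ E] (g : RiemannianMetricOn I M)
    (hg : ∀ a : G, PreservesMetric g (fun x => a • x)) :
    RiemannianMetricOn I (orbitRel.Quotient G M) where
  inner q := sectionInner g q.out q
  symm q v w := by
    rw [sectionInner_apply, sectionInner_apply, g.symm]
  pos q v hv := by
    rw [sectionInner_apply]
    apply g.pos
    intro h
    apply hv
    rw [← mfderiv_quotProj_comp (mem_quotSection_out q) v, h]
    exact map_zero (mfderiv I I (quotProj G M) (quotSection G q.out q))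
  isVonNBounded q := by
    refine ((g.isVonNBounded (quotSection G q.out q)).image
      (mfderiv I I (quotProj G M) (quotSection G q.out q))).subset ?_
    intro v hv
    exact ⟨_, hv, mfderiv_quotProj_comp (mem_quotSection_out q) v⟩
  contMDiff := by
    intro q
    refine (contMDiffAt_sectionInner g (mem_quotSection_out q)).congr_of_eventuallyEq ?_
    filter_upwards [(quotSection G q.out).open_source.mem_nhds (mem_quotSection_out q)] with z hz
    rw [sectionInner_congr hg (mem_quotSection_out z) hz]

/-- `quotientMetric` is the metric for which the projection is a local isometry. -/
theorem quotientMetric_quotProj [FiniteDimensional ℝ E] (g : RiemannianMetricOn I M)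
    (hg : ∀ a : G, PreservesMetric g (fun x => a • x))
   (x : M) (v w : TangentSpace I x) :
    (quotientMetric g hg).inner (quotProj G M x) (mfderiv I I (quotProj G M) x v)
      (mfderiv I I (quotProj G M) x w) = g.inner x v w := by
  change sectionInner g _ _ _ _ = _
  rw [sectionInner_congr hg (mem_quotSection_out _) (mem_quotSection_source x), sectionInner_apply,
    mfderiv_quotSection_comp, mfderiv_quotSection_comp]
  have h : quotSection G x (quotProj G M x) = x :=
    (quotProj_isLocalHomeomorph (G := G)).localInverseAt_apply_self
  have key : ∀ p : M, p = x → (g.inner p : E →L[ℝ] E →L[ℝ] ℝ) v w = g.inner x v w := by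
    rintro _ rfl
    rfl
  exact key _ h

end Quotient

instance instContinuousConstSMulSubgroup {G M : Type*} [TopologicalSpace M] [Group G]
    [MulAction G M] [ContinuousConstSMul G M] (K : Subgroup G) : ContinuousConstSMul K M :=
  ⟨fun a => continuous_const_smul (a : G)⟩

instance instContMDiffConstSMulSubgroup {E : Type*} [NormedAddCommGroup E] [NormedSpace ℝ E]
    {H : Type*} [TopologicalSpace H] {I : ModelWithCorners ℝ E H} {G M : Type*}
    [TopologicalSpace M] [ChartedSpace H M] [Group G] [MulAction G M] [ContMDiffConstSMul I G M]
    (K : Subgroup G) : ContMDiffConstSMul I K M :=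
  ⟨fun a => ContMDiffConstSMul.contMDiff_const_smul (I := I) (a : G)⟩

/-- The function induced by `f` on the orbit space `G \ M`: its value at an orbit is the average of
`f` over that orbit, hence the common value of `f` there if `f` is `G`-invariant, see
`inducedFunction_quotProj`. (The average makes sense of this also when `f` is only invariant up to
null sets.) -/
def inducedFunction (G : Type*) {M : Type*} [Group G] [MulAction G M] (f : M → ℝ)
    (q : orbitRel.Quotient G M) : ℝ :=
  (∑ᶠ x : {x : M // quotProj G M x = q}, f x) / Nat.card {x : M // quotProj G M x = q}

theorem inducedFunction_quotProj {G M : Type*} [Group G] [Finite G] [MulAction G M] {f : M → ℝ}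
    (hf : ∀ (a : G) (x : M), f (a • x) = f x) (x : M) :
    inducedFunction G f (quotProj G M x) = f x := by
  have hval : ∀ y : {y : M // quotProj G M y = quotProj G M x}, f y = f x := by
    rintro ⟨y, hy⟩
    obtain ⟨a, rfl⟩ := Quotient.exact hy
    exact hf a x
  have hfin : Finite {y : M // quotProj G M y = quotProj G M x} := by
    refine Finite.of_surjective (fun a : G => ⟨a • x, Quotient.sound ⟨a, rfl⟩⟩) ?_
    rintro ⟨y, hy⟩
    obtain ⟨a, rfl⟩ := Quotient.exact hy
    exact ⟨a, rfl⟩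
  have hne : Nonempty {y : M // quotProj G M y = quotProj G M x} := ⟨⟨x, rfl⟩⟩
  have := Fintype.ofFinite {y : M // quotProj G M y = quotProj G M x}
  rw [inducedFunction, finsum_eq_sum_of_fintype, Finset.sum_congr rfl fun y _ => hval y,
    Finset.sum_const, Finset.card_univ, nsmul_eq_mul, Nat.card_eq_fintype_card,
    mul_div_cancel_left₀]
  exact_mod_cast Fintype.card_ne_zero

/-! ### Volume, boundary measure and gradient of a Riemannian manifold with boundary -/

section Riemannian

variable {d : ℕ} {N : Type*} [TopologicalSpace N] [ChartedSpace (EuclideanHalfSpace (d + 1)) N]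
  [IsManifold (𝓡∂ (d + 1)) ∞ N] (g : RiemannianMetricOn (𝓡∂ (d + 1)) N)

/-- The matrix `g(∂ᵢ, ∂ⱼ)` of the metric in the coordinates given by the chart `e`, at the point
with coordinates `y`. -/
def gramMatrix (e : OpenPartialHomeomorph N (EuclideanHalfSpace (d + 1)))
    (y : EuclideanSpace ℝ (Fin (d + 1))) : Matrix (Fin (d + 1)) (Fin (d + 1)) ℝ :=
  Matrix.of fun i j =>
    g.inner ((e.extend (𝓡∂ (d + 1))).symm y)
      (mfderivWithin 𝓘(ℝ, EuclideanSpace ℝ (Fin (d + 1))) (𝓡∂ (d + 1))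
        (e.extend (𝓡∂ (d + 1))).symm (range (𝓡∂ (d + 1))) y (EuclideanSpace.single i 1))
      (mfderivWithin 𝓘(ℝ, EuclideanSpace ℝ (Fin (d + 1))) (𝓡∂ (d + 1))
        (e.extend (𝓡∂ (d + 1))).symm (range (𝓡∂ (d + 1))) y (EuclideanSpace.single j 1))

/-- The measure `√det(g(∂ᵢ, ∂ⱼ)) dx₀ ⋯ dx_d` in the domain of the chart `e`, as a Borel measure on
the manifold that vanishes outside of this domain. -/
def chartVolume (e : OpenPartialHomeomorph N (EuclideanHalfSpace (d + 1))) :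
    @Measure N (borel N) :=
  @Measure.map _ _ _ (borel N) (e.extend (𝓡∂ (d + 1))).symm
    ((volume.restrict (e.extend (𝓡∂ (d + 1))).target).withDensity
      fun y => ENNReal.ofReal √(gramMatrix g e y).det)

/-- The inclusion `z ↦ (0, z)` of the boundary hyperplane of the half-space. -/
def boundaryInclusion (z : EuclideanSpace ℝ (Fin d)) : EuclideanSpace ℝ (Fin (d + 1)) :=
  WithLp.toLp 2 (Fin.cons 0 fun i => z i)

/-- The measure `√det(g(∂ᵢ, ∂ⱼ))_{i,j ≥ 1} dx₁ ⋯ dx_d` on the part `x₀ = 0` of the domain of the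
chart `e`, as a Borel measure on the manifold. It is carried by boundary points. -/
def chartBoundaryMeasure (e : OpenPartialHomeomorph N (EuclideanHalfSpace (d + 1))) :
    @Measure N (borel N) :=
  @Measure.map _ _ _ (borel N) (fun z => (e.extend (𝓡∂ (d + 1))).symm (boundaryInclusion z))
    ((volume.restrict (boundaryInclusion ⁻¹' (e.extend (𝓡∂ (d + 1))).target)).withDensity
      fun z => ENNReal.ofReal
        √((gramMatrix g e (boundaryInclusion z)).submatrix Fin.succ Fin.succ).det)

/-- The Riemannian volume measure: the Borel measure that agrees with `chartVolume g e` in the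
domain of every smooth chart `e`. As these agree on overlaps, it is the infimum of the measures that
equal `chartVolume g e` in the domain of `e` and are infinite on all nonempty sets outside. -/
def riemannianVolume : @Measure N (borel N) :=
  ⨅ e ∈ IsManifold.maximalAtlas (𝓡∂ (d + 1)) ∞ N,
    (chartVolume g e + @Measure.restrict N (borel N) ⊤ e.sourceᶜ)

/-- The Riemannian measure of the boundary `∂N` with the induced metric, as a Borel measure on `N`
carried by `∂N`: it agrees with `chartBoundaryMeasure g e` in the domain of every smooth chart `e`
(see `riemannianVolume` for the infimum). Functions on `∂N` are written as functions on `N`, of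
which only the values on `∂N` matter. -/
def boundaryMeasure : @Measure N (borel N) :=
  ⨅ e ∈ IsManifold.maximalAtlas (𝓡∂ (d + 1)) ∞ N,
    (chartBoundaryMeasure g e + @Measure.restrict N (borel N) ⊤ e.sourceᶜ)

theorem exists_gradient (x : N) (l : TangentSpace (𝓡∂ (d + 1)) x →L[ℝ] ℝ) :
    ∃ w : TangentSpace (𝓡∂ (d + 1)) x, ∀ v, g.inner x w v = l v := by
  let B : EuclideanSpace ℝ (Fin (d + 1)) →ₗ[ℝ] Module.Dual ℝ (EuclideanSpace ℝ (Fin (d + 1))) :=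
    { toFun := fun w => (g.inner x w : TangentSpace (𝓡∂ (d + 1)) x →L[ℝ] ℝ).toLinearMap
      map_add' := fun w w' => by
        ext v
        exact congrArg (fun L : TangentSpace (𝓡∂ (d + 1)) x →L[ℝ] ℝ => L v)
          ((g.inner x).map_add w w')
      map_smul' := fun c w => by
        ext v
        exact congrArg (fun L : TangentSpace (𝓡∂ (d + 1)) x →L[ℝ] ℝ => L v)
          ((g.inner x).map_smul c w) }
  have hB : Function.Injective B := by
    refine (injective_iff_map_eq_zero B).2 fun w hw => ?_
    by_contra h
    have h1 := g.pos x w h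
    have h2 : g.inner x w w = B w w := rfl
    rw [h2, hw] at h1
    exact lt_irrefl _ h1
  obtain ⟨w, hw⟩ := (LinearMap.injective_iff_surjective_of_finrank_eq_finrank
    Subspace.dual_finrank_eq.symm).1 hB l.toLinearMap
  exact ⟨w, fun v => congrArg (fun L : Module.Dual ℝ (EuclideanSpace ℝ (Fin (d + 1))) => L v) hw⟩

/-- The gradient of `φ` at `x`: the tangent vector with `g(∇φ, v) = dφ(v)` for all `v`. -/
def riemannianGradient (φ : C^∞⟮𝓡∂ (d + 1), N; 𝓘(ℝ, ℝ), ℝ⟯) (x : N) :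
    TangentSpace (𝓡∂ (d + 1)) x :=
  (exists_gradient g x (mfderiv (𝓡∂ (d + 1)) 𝓘(ℝ, ℝ) φ x)).choose

theorem inner_riemannianGradient (φ : C^∞⟮𝓡∂ (d + 1), N; 𝓘(ℝ, ℝ), ℝ⟯) (x : N)
    (v : TangentSpace (𝓡∂ (d + 1)) x) :
    g.inner x (riemannianGradient g φ x) v = mfderiv (𝓡∂ (d + 1)) 𝓘(ℝ, ℝ) φ x v :=
  (exists_gradient g x (mfderiv (𝓡∂ (d + 1)) 𝓘(ℝ, ℝ) φ x)).choose_spec v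

/-! ### The Dirichlet and the Steklov spectrum of a compact Riemannian manifold with boundary

`H¹(N)` is the completion of `C^∞(N)` for the norm `‖φ‖²_{L²(N)} + ‖∇φ‖²_{L²(N)}`. Its elements are
the limits `u` in `L²(N)` of sequences `φₖ` in `C^∞(N)` for which `∇φₖ` is a Cauchy sequence in
`L²`; then `∇u` is the limit of `∇φₖ`, so that `∫ ⟨∇u, ∇ψ⟩ = lim ∫ ⟨∇φₖ, ∇ψ⟩`, and the trace of `u`
on the boundary is the limit of `φₖ` in `L²(∂N)`. -/

/-- `∫ ⟨∇φ, ∇ψ⟩` -/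
def dirichletForm (φ ψ : C^∞⟮𝓡∂ (d + 1), N; 𝓘(ℝ, ℝ), ℝ⟯) : ℝ :=
  ∫ x, g.inner x (riemannianGradient g φ x) (riemannianGradient g ψ x) ∂riemannianVolume g

/-- The sequence `φₖ` of smooth functions converges to `u` in `H¹(N)`. -/
def TendstoH1 (φ : ℕ → C^∞⟮𝓡∂ (d + 1), N; 𝓘(ℝ, ℝ), ℝ⟯) (u : Lp ℝ 2 (riemannianVolume g)) : Prop :=
  Tendsto (fun k => eLpNorm (fun x => φ k x - u x) 2 (riemannianVolume g)) atTop (𝓝 0) ∧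
  Tendsto (fun p : ℕ × ℕ => ∫⁻ x, ENNReal.ofReal
      (g.inner x (riemannianGradient g (φ p.1) x - riemannianGradient g (φ p.2) x)
        (riemannianGradient g (φ p.1) x - riemannianGradient g (φ p.2) x)) ∂riemannianVolume g)
    atTop (𝓝 0)

/-- The Dirichlet spectrum of `N`: the numbers `α` such that `Δu = αu` (with `Δ = -div grad`) has a
nontrivial weak solution `u` in `H¹₀(N)`, the closure in `H¹(N)` of the smooth functions with
support in the interior of `N`. -/
def dirichletSpectrum : Set ℝ :=
  {α | ∃ u : Lp ℝ 2 (riemannianVolume g), u ≠ 0 ∧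
    ∃ φ : ℕ → C^∞⟮𝓡∂ (d + 1), N; 𝓘(ℝ, ℝ), ℝ⟯,
      (∀ k, tsupport (φ k) ⊆ (𝓡∂ (d + 1)).interior N) ∧ TendstoH1 g φ u ∧
      ∀ ψ : C^∞⟮𝓡∂ (d + 1), N; 𝓘(ℝ, ℝ), ℝ⟯, tsupport ψ ⊆ (𝓡∂ (d + 1)).interior N →
        Tendsto (fun k => dirichletForm g (φ k) ψ) atTop
          (𝓝 (α * ∫ x, u x * ψ x ∂riemannianVolume g))}

/-- `u ∈ H¹(N)` solves `Δu = αu` in the interior of `N` and `∂_ν u = σρu` on `∂N`, in the weak sense: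
`∫_N ⟨∇u, ∇ψ⟩ = α ∫_N uψ + σ ∫_{∂N} ρ (tr u) ψ` for all smooth functions `ψ` on `N`, where `tr u`
is the Sobolev trace of `u`, called `f` below. -/
def IsSteklovSolution (α : ℝ) (ρ : N → ℝ) (σ : ℝ) (u : Lp ℝ 2 (riemannianVolume g)) : Prop :=
  ∃ (φ : ℕ → C^∞⟮𝓡∂ (d + 1), N; 𝓘(ℝ, ℝ), ℝ⟯) (f : Lp ℝ 2 (boundaryMeasure g)),
    TendstoH1 g φ u ∧
    Tendsto (fun k => eLpNorm (fun x => φ k x - f x) 2 (boundaryMeasure g)) atTop (𝓝 0) ∧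
    ∀ ψ : C^∞⟮𝓡∂ (d + 1), N; 𝓘(ℝ, ℝ), ℝ⟯,
      Tendsto (fun k => dirichletForm g (φ k) ψ) atTop
        (𝓝 (α * ∫ x, u x * ψ x ∂riemannianVolume g +
          σ * ∫ x, ρ x * f x * ψ x ∂boundaryMeasure g))

/-- The Steklov spectrum of `N` at frequency `α` with boundary density `ρ`, as a set. -/
def steklovSpectrum (α : ℝ) (ρ : N → ℝ) : Set ℝ :=
  {σ | ∃ u : Lp ℝ 2 (riemannianVolume g), u ≠ 0 ∧ IsSteklovSolution g α ρ σ u}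

/-- The multiplicity of `σ` in the Steklov spectrum: the dimension of the space of solutions.
(The solutions form a subspace already, so that taking their span changes nothing.) -/
def steklovMultiplicity (α : ℝ) (ρ : N → ℝ) (σ : ℝ) : Cardinal :=
  Module.rank ℝ (Submodule.span ℝ {u | IsSteklovSolution g α ρ σ u})

end Riemannian

/-- Almost conjugate (Gassmann equivalent) subgroups: every element of `G` has equally many
conjugates in both. -/
def AlmostConjugate {G : Type*} [Group G] (H H' : Subgroup G) : Prop :=
  ∀ a : G, {b : G | IsConj a b ∧ b ∈ H}.ncard = {b : G | IsConj a b ∧ b ∈ H'}.ncard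

end Steklov

end

open Steklov

/-!
Let `S(ρ)` be the space of weak solutions on `M` for given `α` and `σ`. The theorem follows from
three facts:

* The solutions on `H \ M` are, by composition with the projection, the `H`-invariant elements of
  `S(ρ)` (`rank_solutions_quotient`).
* `S(ρ)` is stable under the representation of `G` on `L²(M)`, because `ρ` is `G`-invariant. For
  every representation the invariants of almost conjugate subgroups have the same dimension
  (`AlmostConjugate.rank_inf_invariantsOf`): in finite dimension this is the average of the
  character over the subgroup, and in general a finite-dimensional set of invariants generates a
  finite-dimensional representation. Hence `S(ρ)` has as many `H`-invariant elements as
  `H'`-invariant ones.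
* Composition with `τ` maps `S(ρ)` to `S(ρ ∘ τ)`, and, as `τ H τ⁻¹ = H'`, the `H'`-invariant
  elements to the `H`-invariant ones (`PreservesMetric.rank_inf_invariantsOf_comp`).

Solutions are limits of smooth functions, which is captured by `WeakProblem`. To transport them
along a map it suffices to have maps of smooth functions in both directions that are compatible
with the `L²` norms and adjoint for the energy (`WeakProblem.solutions_of_adjoint`): for an
isometry, composition with it and with its inverse, and for the projection, composition with it and
the average over orbits. That these are compatible with the measures rests on the invariance of
volume and boundary measure under partial isometries
(`IsPartialIsometry.riemannianVolume_preimage`, `IsPartialIsometry.boundaryMeasure_preimage`).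
Dimensions are cardinals throughout, and no finiteness of `S(ρ)` is needed.
-/

set_option linter.unusedSectionVars false

noncomputable section

namespace Steklov

/-! ### Invariants of almost conjugate subgroups -/

section Gassmann

variable {G : Type*} [Group G] {H H' : Subgroup G}

theorem AlmostConjugate.symm (h : AlmostConjugate H H') : AlmostConjugate H' H :=
  fun a => (h a).symm

/-- Class functions have the same sum over almost conjugate subgroups. -/
theorem AlmostConjugate.sum_eq [Fintype G] [Fintype H] [Fintype H'] {k : Type*} [Semiring k]
    (h : AlmostConjugate H H') {f : G → k} (hf : ∀ a b, IsConj a b → f a = f b) :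
    ∑ a : H, f a = ∑ a : H', f a := by
  classical
  have key : ∀ (K : Subgroup G) [Fintype K], ∑ a : K, f a =
      ∑ c : ConjClasses G, ({b : G | IsConj c.exists_rep.choose b ∧ b ∈ K}.ncard : k) *
        f c.exists_rep.choose := by
    intro K _
    rw [← Finset.sum_fiberwise (Finset.univ : Finset K) (fun a => ConjClasses.mk (a : G))]
    refine Finset.sum_congr rfl fun c _ => ?_
    have hc := c.exists_rep.choose_spec
    have h1 : ∀ b : G, ConjClasses.mk b = c ↔ IsConj c.exists_rep.choose b := by
      intro b
      rw [← ConjClasses.mk_eq_mk_iff_isConj, hc, eq_comm]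
    have h2 : ∀ a ∈ Finset.univ.filter (fun a : K => ConjClasses.mk (a : G) = c),
        f a = f c.exists_rep.choose :=
      fun a ha => (hf _ _ ((h1 a).1 (Finset.mem_filter.1 ha).2)).symm
    rw [Finset.sum_congr rfl h2, Finset.sum_const, nsmul_eq_mul]
    congr 2
    rw [← Set.ncard_coe_finset, ← Set.ncard_image_of_injective _ Subtype.val_injective]
    congr 1
    ext b
    constructor
    · rintro ⟨a, ha, rfl⟩
      exact ⟨(h1 a).1 (Finset.mem_filter.1 ha).2, a.2⟩
    · rintro ⟨hb, hbK⟩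
      exact ⟨⟨b, hbK⟩, Finset.mem_filter.2 ⟨Finset.mem_univ _, (h1 b).2 hb⟩, rfl⟩
  rw [key H, key H']
  exact Finset.sum_congr rfl fun c _ => by rw [h]

variable {k V : Type*} [Field k] [AddCommGroup V] [Module k V]

theorem rank_iSup_map_le [Finite G] (r : Representation k G V) (U : Submodule k V) :
    Module.rank k ↥(⨆ a, U.map (r a)) ≤ Nat.card G * Module.rank k U := by
  classical
  have := Fintype.ofFinite G
  have key : ∀ s : Finset G,
      Module.rank k ↥(s.sup fun a => U.map (r a)) ≤ s.card * Module.rank k U := by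
    intro s
    induction s using Finset.induction_on with
    | empty => simp
    | insert a s ha ih =>
      rw [Finset.sup_insert, Finset.card_insert_of_notMem ha, Nat.cast_add, Nat.cast_one, add_comm,
        add_mul, one_mul]
      exact (Submodule.rank_add_le_rank_add_rank _ _).trans (add_le_add (rank_map_le _ _) ih)
  have := key Finset.univ
  rwa [Finset.sup_univ_eq_iSup, Finset.card_univ, ← Nat.card_eq_fintype_card] at this

theorem iSup_map_le_comap (r : Representation k G V) (U : Submodule k V) (a : G) :
    ⨆ b, U.map (r b) ≤ (⨆ b, U.map (r b)).comap (r a) := by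
  refine iSup_le fun b => ?_
  rw [← Submodule.map_le_iff_le_comap, ← Submodule.map_comp]
  refine le_trans (le_of_eq ?_) (le_iSup _ (a * b))
  rw [map_mul]
  rfl

theorem le_iSup_map (r : Representation k G V) (U : Submodule k V) :
    U ≤ ⨆ b, U.map (r b) := by
  refine le_trans (le_of_eq ?_) (le_iSup _ 1)
  rw [map_one]
  exact (Submodule.map_id U).symm

variable [CharZero k]

/-- The vectors fixed by a subgroup. -/
abbrev invariantsOf (r : Representation k G V) (K : Subgroup G) : Submodule k V :=
  Representation.invariants (MonoidHom.comp r K.subtype : Representation k K V)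

/-- The dimension of the space of invariants is the average of the character, which is a class
function. -/
theorem AlmostConjugate.finrank_invariantsOf [Finite G] [FiniteDimensional k V]
    (h : AlmostConjugate H H') (r : Representation k G V) :
    Module.finrank k (invariantsOf r H) = Module.finrank k (invariantsOf r H') := by
  classical
  have := Fintype.ofFinite G
  have hf : ∀ a b, IsConj a b → r.character a = r.character b := by
    intro a b hab
    obtain ⟨c, rfl⟩ := isConj_iff.1 hab
    exact (r.char_conj a c).symm
  have h1 : ∀ (K : Subgroup G), (Nat.card K : k)⁻¹ * ∑ a : K, r.character a =
      Module.finrank k (invariantsOf r K) := by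
    intro K
    have : Invertible (Nat.card K : k) := invertibleOfNonzero (by exact_mod_cast Nat.card_pos.ne')
    exact Representation.card_inv_mul_sum_char_eq_finrank
      (MonoidHom.comp r K.subtype : Representation k K V)
  have h2 : (Nat.card H : k) = Nat.card H' := by
    have := h.sum_eq (f := fun _ => (1 : k)) (fun _ _ _ => rfl)
    simpa using this
  have h3 := h.sum_eq hf
  have h4 := h1 H
  rw [h2, h3, h1 H'] at h4
  exact_mod_cast h4.symm

theorem inf_invariantsOf_eq_map (r : Representation k G V) (U : Submodule k V)
    (hU : ∀ a, U ≤ U.comap (r a)) (K : Subgroup G) :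
    U ⊓ invariantsOf r K = (invariantsOf (r.subrepresentation U hU) K).map U.subtype := by
  ext v
  simp only [Submodule.mem_inf, Submodule.mem_map, Representation.mem_invariants]
  constructor
  · rintro ⟨h1, h2⟩
    exact ⟨⟨v, h1⟩, fun a => Subtype.ext (h2 a), rfl⟩
  · rintro ⟨w, h1, rfl⟩
    exact ⟨w.2, fun a => congrArg Subtype.val (h1 a)⟩

theorem AlmostConjugate.finrank_inf_invariantsOf [Finite G] (h : AlmostConjugate H H')
    (r : Representation k G V) (U : Submodule k V) [FiniteDimensional k U]
    (hU : ∀ a, U ≤ U.comap (r a)) :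
    Module.finrank k ↥(U ⊓ invariantsOf r H) = Module.finrank k ↥(U ⊓ invariantsOf r H') := by
  rw [inf_invariantsOf_eq_map r U hU, inf_invariantsOf_eq_map r U hU,
    Submodule.finrank_map_subtype_eq, Submodule.finrank_map_subtype_eq, h.finrank_invariantsOf]

/-- Within the finite-dimensional representation generated by an `H`-invariant vector, all
`H'`-invariants lie in the subrepresentation on the right-hand side; by the equality of dimensions,
so do all `H`-invariants. -/
theorem AlmostConjugate.invariantsOf_le_iSup_map [Finite G] (h : AlmostConjugate H H')
    (r : Representation k G V) :
    invariantsOf r H ≤ ⨆ a, (invariantsOf r H').map (r a) := by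
  intro v hv
  -- `W` is generated by all `H'`-invariants, `W₁` by the single vector `v`
  set W := ⨆ a, (invariantsOf r H').map (r a)
  set W₁ := ⨆ a, (k ∙ v).map (r a)
  have hv₁ : v ∈ W₁ := le_iSup_map r _ (Submodule.mem_span_singleton_self v)
  have hW₁ : FiniteDimensional k W₁ := by
    have : ∀ a, FiniteDimensional k ↥((k ∙ v).map (r a)) := fun a => inferInstance
    exact Submodule.finite_iSup _
  have hW₂ : FiniteDimensional k ↥(W ⊓ W₁) := Submodule.finiteDimensional_inf_right _ _
  have h1 := h.finrank_inf_invariantsOf r W₁ (iSup_map_le_comap r _)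
  have h2 := h.finrank_inf_invariantsOf r (W ⊓ W₁) fun a =>
    inf_le_inf (iSup_map_le_comap r _ a) (iSup_map_le_comap r _ a)
  have h3 : W ⊓ W₁ ⊓ invariantsOf r H' = W₁ ⊓ invariantsOf r H' := by
    rw [inf_comm W, inf_assoc, inf_eq_right.2 (le_iSup_map r _)]
  rw [h3, ← h1] at h2
  have h4 : W ⊓ W₁ ⊓ invariantsOf r H = W₁ ⊓ invariantsOf r H :=
    Submodule.eq_of_le_of_finrank_eq (inf_le_inf_right _ inf_le_right) h2
  have h5 : v ∈ W ⊓ W₁ ⊓ invariantsOf r H := by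
    rw [h4]
    exact ⟨hv₁, hv⟩
  exact h5.1.1

/-- Almost conjugate subgroups have invariants of the same dimension in every representation,
also an infinite-dimensional one. -/
theorem AlmostConjugate.rank_invariantsOf [Finite G] (h : AlmostConjugate H H')
    (r : Representation k G V) :
    Module.rank k (invariantsOf r H) = Module.rank k (invariantsOf r H') := by
  -- if the `H'`-invariants have finite dimension, they generate a finite-dimensional
  -- representation that contains the `H`-invariants; otherwise the dimension of the representation
  -- that they generate is that of the `H'`-invariants themselves
  rcases lt_or_ge (Module.rank k (invariantsOf r H')) Cardinal.aleph0 with hlt | hge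
  · have : FiniteDimensional k (invariantsOf r H') := Module.rank_lt_aleph0_iff.1 hlt
    have hW : FiniteDimensional k ↥(⨆ a, (invariantsOf r H').map (r a)) :=
      Submodule.finite_iSup _
    have h1 := h.finrank_inf_invariantsOf r _ (iSup_map_le_comap r (invariantsOf r H'))
    have h2 := h.invariantsOf_le_iSup_map r
    rw [inf_eq_right.2 h2, inf_eq_right.2 (le_iSup_map r _)] at h1
    have : FiniteDimensional k (invariantsOf r H) := Submodule.finiteDimensional_of_le h2
    rw [← Module.finrank_eq_rank, ← Module.finrank_eq_rank, h1]
  · have key : ∀ {K K' : Subgroup G}, AlmostConjugate K K' →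
        Cardinal.aleph0 ≤ Module.rank k (invariantsOf r K') →
        Module.rank k (invariantsOf r K) ≤ Module.rank k (invariantsOf r K') := by
      intro K K' hK hinf
      refine (Submodule.rank_mono (hK.invariantsOf_le_iSup_map r)).trans
        ((rank_iSup_map_le r _).trans ?_)
      exact Cardinal.mul_le_of_le hinf ((Cardinal.natCast_lt_aleph0).le.trans hinf) le_rfl
    refine le_antisymm (key h hge) (key h.symm ?_)
    by_contra! hfin
    have : FiniteDimensional k (invariantsOf r H) := Module.rank_lt_aleph0_iff.1 hfin
    have hW : FiniteDimensional k ↥(⨆ a, (invariantsOf r H).map (r a)) :=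
      Submodule.finite_iSup _
    have : FiniteDimensional k (invariantsOf r H') :=
      Submodule.finiteDimensional_of_le (h.symm.invariantsOf_le_iSup_map r)
    exact absurd hge (not_le.2 (Module.rank_lt_aleph0_iff.2 this))

theorem AlmostConjugate.rank_inf_invariantsOf [Finite G] (h : AlmostConjugate H H')
    (r : Representation k G V) (U : Submodule k V) (hU : ∀ a, U ≤ U.comap (r a)) :
    Module.rank k ↥(U ⊓ invariantsOf r H) = Module.rank k ↥(U ⊓ invariantsOf r H') := by
  have key : ∀ K : Subgroup G, Module.rank k ↥(U ⊓ invariantsOf r K) =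
      Module.rank k (invariantsOf (r.subrepresentation U hU) K) := by
    intro K
    rw [inf_invariantsOf_eq_map r U hU]
    exact (Submodule.equivMapOfInjective _ U.injective_subtype _).rank_eq.symm
  rw [key, key, h.rank_invariantsOf]

end Gassmann

/-! ### Weak eigenvalue problems with a spectral parameter on the boundary -/

/-- The functional-analytic data of a weak Steklov problem: a space `C` of test functions, mapped to
Hilbert spaces `X` (the functions in the interior) by `incl` and `Y` (the functions on the boundary)
by `trace` and by `weight` (the trace multiplied by the density), and the energy form. -/
structure WeakProblem (C X Y : Type*) [AddCommGroup C] [Module ℝ C] [NormedAddCommGroup X]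
    [InnerProductSpace ℝ X] [NormedAddCommGroup Y] [InnerProductSpace ℝ Y] where
  /-- The inclusion of the test functions in `X`. -/
  incl : C →ₗ[ℝ] X
  /-- The boundary values of the test functions. -/
  trace : C →ₗ[ℝ] Y
  /-- The boundary values of the test functions, multiplied by the density. -/
  weight : C →ₗ[ℝ] Y
  /-- The energy form. -/
  energy : C →ₗ[ℝ] C →ₗ[ℝ] ℝ
  energy_nonneg : ∀ φ, 0 ≤ energy φ φ

namespace WeakProblem

variable {C X Y : Type*} [AddCommGroup C] [Module ℝ C] [NormedAddCommGroup X]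
  [InnerProductSpace ℝ X] [NormedAddCommGroup Y] [InnerProductSpace ℝ Y] (S : WeakProblem C X Y)

theorem energy_add_le (a b : C) :
    S.energy (a + b) (a + b) ≤ 2 * S.energy a a + 2 * S.energy b b := by
  have h := S.energy_nonneg (a - b)
  simp only [map_add, map_sub, LinearMap.add_apply, LinearMap.sub_apply] at h ⊢
  linarith

/-- `u` is the limit, in the closure of the test functions for the energy norm, of a sequence whose
boundary values converge, and it solves the equation with parameters `α` and `σ` weakly. -/
def IsSolution (α σ : ℝ) (u : X) : Prop :=
  ∃ (φ : ℕ → C) (f : Y), Tendsto (fun k => S.incl (φ k)) atTop (𝓝 u) ∧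
    Tendsto (fun p : ℕ × ℕ => S.energy (φ p.1 - φ p.2) (φ p.1 - φ p.2)) atTop (𝓝 0) ∧
    Tendsto (fun k => S.trace (φ k)) atTop (𝓝 f) ∧
    ∀ ψ, Tendsto (fun k => S.energy (φ k) ψ) atTop
      (𝓝 (α * inner ℝ u (S.incl ψ) + σ * inner ℝ f (S.weight ψ)))

/-- The space of solutions. -/
def solutions (α σ : ℝ) : Submodule ℝ X where
  carrier := {u | S.IsSolution α σ u}
  zero_mem' := ⟨0, 0, by simp, by simp, by simp, by simp⟩
  add_mem' := by
    rintro u u' ⟨φ, f, h1, h2, h3, h4⟩ ⟨φ', f', h1', h2', h3', h4'⟩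
    refine ⟨φ + φ', f + f', ?_, ?_, ?_, fun ψ => ?_⟩
    · simpa using h1.add h1'
    · refine squeeze_zero (fun _ => S.energy_nonneg _) (fun p => ?_)
        (by simpa only [mul_zero, add_zero] using (h2.const_mul 2).add (h2'.const_mul 2))
      have h : (φ + φ') p.1 - (φ + φ') p.2 = (φ p.1 - φ p.2) + (φ' p.1 - φ' p.2) := by
        simp only [Pi.add_apply]
        abel
      rw [h]
      exact S.energy_add_le _ _
    · simpa using h3.add h3'
    · have h : α * inner ℝ (u + u') (S.incl ψ) + σ * inner ℝ (f + f') (S.weight ψ) =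
          (α * inner ℝ u (S.incl ψ) + σ * inner ℝ f (S.weight ψ)) +
          (α * inner ℝ u' (S.incl ψ) + σ * inner ℝ f' (S.weight ψ)) := by
        rw [inner_add_left, inner_add_left]
        ring
      rw [h]
      simpa using (h4 ψ).add (h4' ψ)
  smul_mem' := by
    rintro c u ⟨φ, f, h1, h2, h3, h4⟩
    refine ⟨c • φ, c • f, ?_, ?_, ?_, fun ψ => ?_⟩
    · simpa using h1.const_smul c
    · have h : ∀ p : ℕ × ℕ, S.energy ((c • φ) p.1 - (c • φ) p.2) ((c • φ) p.1 - (c • φ) p.2) =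
          c * (c * S.energy (φ p.1 - φ p.2) (φ p.1 - φ p.2)) := by
        intro p
        simp only [Pi.smul_apply, ← smul_sub, map_smul, LinearMap.smul_apply, smul_eq_mul]
      simp only [h]
      simpa using (h2.const_mul c).const_mul c
    · simpa using h3.const_smul c
    · have h : α * inner ℝ (c • u) (S.incl ψ) + σ * inner ℝ (c • f) (S.weight ψ) =
          c * (α * inner ℝ u (S.incl ψ) + σ * inner ℝ f (S.weight ψ)) := by
        rw [real_inner_smul_left, real_inner_smul_left]
        ring
      rw [h]
      simpa using (h4 ψ).const_mul c

theorem mem_solutions {α σ : ℝ} {u : X} : u ∈ S.solutions α σ ↔ S.IsSolution α σ u := Iff.rfl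

variable {S} {C' X' Y' : Type*} [AddCommGroup C'] [Module ℝ C'] [NormedAddCommGroup X']
  [InnerProductSpace ℝ X'] [NormedAddCommGroup Y'] [InnerProductSpace ℝ Y']
  {S' : WeakProblem C' X' Y'}

/-- Maps of the functions in the interior and on the boundary that are compatible with a map `PC` of
test functions, and that have, up to the constant `c`, a map `QC` of test functions in the opposite
direction as their adjoint, send solutions to solutions. -/
theorem map_mem_solutions {α σ : ℝ} {PC : C → C'} {QC : C' → C} {PX : X →L[ℝ] X'}
    {PY : Y →L[ℝ] Y'} {c K : ℝ} (hsub : ∀ a b, PC (a - b) = PC a - PC b)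
    (hincl : ∀ φ, PX (S.incl φ) = S'.incl (PC φ))
    (htrace : ∀ φ, PY (S.trace φ) = S'.trace (PC φ))
    (hle : ∀ φ, S'.energy (PC φ) (PC φ) ≤ K * S.energy φ φ)
    (henergy : ∀ φ ψ, S'.energy (PC φ) ψ = c * S.energy φ (QC ψ))
    (hX : ∀ x ψ, inner ℝ (PX x) (S'.incl ψ) = c * inner ℝ x (S.incl (QC ψ)))
    (hY : ∀ y ψ, inner ℝ (PY y) (S'.weight ψ) = c * inner ℝ y (S.weight (QC ψ)))
    {u : X} (hu : u ∈ S.solutions α σ) : PX u ∈ S'.solutions α σ := by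
  obtain ⟨φ, f, h1, h2, h3, h4⟩ := hu
  refine ⟨fun k => PC (φ k), PY f, ?_, ?_, ?_, fun ψ => ?_⟩
  · simp only [← hincl]
    exact (PX.continuous.tendsto u).comp h1
  · refine squeeze_zero (fun _ => S'.energy_nonneg _) (fun p => ?_)
      (by simpa only [mul_zero] using h2.const_mul K)
    rw [← hsub]
    exact hle _
  · simp only [← htrace]
    exact (PY.continuous.tendsto f).comp h3
  · have h : α * inner ℝ (PX u) (S'.incl ψ) + σ * inner ℝ (PY f) (S'.weight ψ) =
        c * (α * inner ℝ u (S.incl (QC ψ)) + σ * inner ℝ f (S.weight (QC ψ))) := by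
      rw [hX, hY]
      ring
    rw [h]
    simpa only [henergy] using (h4 (QC ψ)).const_mul c

/-- Up to the factor `c`, a map that is adjoint to an isometry does not increase the energy. -/
theorem energy_adjoint_le {PC : C →ₗ[ℝ] C'} {QC : C' →ₗ[ℝ] C} {c : ℝ} (hc : 0 < c)
    (hsymm : ∀ φ ψ, S'.energy φ ψ = S'.energy ψ φ)
    (henergy : ∀ φ ψ, S'.energy (PC φ) ψ = c * S.energy φ (QC ψ)) (hQP : ∀ φ, QC (PC φ) = φ)
    (ψ : C') : S.energy (QC ψ) (QC ψ) ≤ c⁻¹ * S'.energy ψ ψ := by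
  -- `PC ∘ QC` is the orthogonal projection to the range of `PC`
  have h := S'.energy_nonneg (ψ - PC (QC ψ))
  have h1 := henergy (QC ψ) ψ
  have h2 := henergy (QC ψ) (PC (QC ψ))
  rw [hQP] at h2
  simp only [map_sub, LinearMap.sub_apply, hsymm ψ (PC (QC ψ)), h1, h2] at h
  rw [inv_mul_eq_div, le_div_iff₀ hc]
  linarith

/-- An isometry of weak problems, up to the factor `c`, and its adjoint send solutions to
solutions. -/
theorem solutions_of_adjoint {α σ : ℝ} {PC : C →ₗ[ℝ] C'} {QC : C' →ₗ[ℝ] C}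
    {PX : X →L[ℝ] X'} {PY : Y →L[ℝ] Y'} {QX : X' →L[ℝ] X} {QY : Y' →L[ℝ] Y} {c : ℝ} (hc : 0 < c)
    (hQP : ∀ φ, QC (PC φ) = φ)
    (hPincl : ∀ φ, PX (S.incl φ) = S'.incl (PC φ))
    (hQincl : ∀ ψ, QX (S'.incl ψ) = S.incl (QC ψ))
    (hPtrace : ∀ φ, PY (S.trace φ) = S'.trace (PC φ))
    (hQtrace : ∀ ψ, QY (S'.trace ψ) = S.trace (QC ψ))
    (hPweight : ∀ φ, PY (S.weight φ) = S'.weight (PC φ))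
    (hQweight : ∀ ψ, QY (S'.weight ψ) = S.weight (QC ψ))
    (hX : ∀ x y, inner ℝ (PX x) y = c * inner ℝ x (QX y))
    (hY : ∀ x y, inner ℝ (PY x) y = c * inner ℝ x (QY y))
    (hsymm : ∀ φ ψ, S.energy φ ψ = S.energy ψ φ)
    (hsymm' : ∀ φ ψ, S'.energy φ ψ = S'.energy ψ φ)
    (henergy : ∀ φ ψ, S'.energy (PC φ) ψ = c * S.energy φ (QC ψ)) :
    (∀ u ∈ S.solutions α σ, PX u ∈ S'.solutions α σ) ∧
      ∀ u ∈ S'.solutions α σ, QX u ∈ S.solutions α σ := by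
  have hX' : ∀ y x, inner ℝ (QX y) x = c⁻¹ * inner ℝ y (PX x) := fun y x => by
    rw [real_inner_comm, real_inner_comm (PX x), hX, inv_mul_cancel_left₀ hc.ne']
  have hY' : ∀ y x, inner ℝ (QY y) x = c⁻¹ * inner ℝ y (PY x) := fun y x => by
    rw [real_inner_comm, real_inner_comm (PY x), hY, inv_mul_cancel_left₀ hc.ne']
  constructor
  · intro u hu
    refine map_mem_solutions (PC := PC) (QC := QC) (PY := PY) (c := c) (K := c) (map_sub PC) hPincl
      hPtrace (fun φ => ?_) henergy (fun x ψ => ?_) (fun y ψ => ?_) hu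
    · rw [henergy, hQP]
    · rw [hX, hQincl]
    · rw [hY, hQweight]
  · intro u hu
    refine map_mem_solutions (PC := QC) (QC := PC) (PY := QY) (c := c⁻¹) (K := c⁻¹) (map_sub QC)
      hQincl hQtrace (energy_adjoint_le hc hsymm' henergy hQP) (fun ψ φ => ?_) (fun x ψ => ?_)
      (fun y ψ => ?_) hu
    · rw [hsymm, hsymm', henergy, inv_mul_cancel_left₀ hc.ne']
    · rw [hX', hPincl]
    · rw [hY', hPweight]

end WeakProblem

/-! ### Local isometries preserve the volume and the boundary measure -/

section Charts

variable {d : ℕ} {M N : Type*} [TopologicalSpace M] [TopologicalSpace N]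

theorem extend_trans_target_subset (P : OpenPartialHomeomorph M N)
    (e : OpenPartialHomeomorph N (EuclideanHalfSpace (d + 1))) :
    ((P.trans e).extend (𝓡∂ (d + 1))).target ⊆ (e.extend (𝓡∂ (d + 1))).target := by
  intro y hy
  rw [OpenPartialHomeomorph.extend_target] at hy ⊢
  exact ⟨hy.1.1, hy.2⟩

theorem extend_symm_mem_target_of_mem_trans_target {P : OpenPartialHomeomorph M N}
    {e : OpenPartialHomeomorph N (EuclideanHalfSpace (d + 1))}
    {y : EuclideanSpace ℝ (Fin (d + 1))}
    (hy : y ∈ ((P.trans e).extend (𝓡∂ (d + 1))).target) :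
    (e.extend (𝓡∂ (d + 1))).symm y ∈ P.target := by
  rw [OpenPartialHomeomorph.extend_target] at hy
  exact hy.1.2

theorem extend_trans_symm_apply (P : OpenPartialHomeomorph M N)
    (e : OpenPartialHomeomorph N (EuclideanHalfSpace (d + 1)))
    (y : EuclideanSpace ℝ (Fin (d + 1))) :
    ((P.trans e).extend (𝓡∂ (d + 1))).symm y = P.symm ((e.extend (𝓡∂ (d + 1))).symm y) := rfl

theorem contMDiffWithinAt_extend_symm_range [ChartedSpace (EuclideanHalfSpace (d + 1)) N]
    {e : OpenPartialHomeomorph N (EuclideanHalfSpace (d + 1))}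
    (he : e ∈ IsManifold.maximalAtlas (𝓡∂ (d + 1)) ∞ N) {y : EuclideanSpace ℝ (Fin (d + 1))}
    (hy : y ∈ (e.extend (𝓡∂ (d + 1))).target) :
    ContMDiffWithinAt 𝓘(ℝ, EuclideanSpace ℝ (Fin (d + 1))) (𝓡∂ (d + 1)) ∞
      (e.extend (𝓡∂ (d + 1))).symm (range (𝓡∂ (d + 1))) y := by
  have h := contMDiffOn_extend_symm he
  rw [← e.extend_target'] at h
  refine (h y hy).mono_of_mem_nhdsWithin ?_
  have h1 := e.extend_target_mem_nhdsWithin (I := 𝓡∂ (d + 1))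
    (by simpa only [OpenPartialHomeomorph.extend_source] using
      (e.extend (𝓡∂ (d + 1))).map_target hy)
  rw [(e.extend (𝓡∂ (d + 1))).right_inv hy] at h1
  exact h1

end Charts

section LocalIsometry

variable {d : ℕ} {M N : Type*} [TopologicalSpace M] [ChartedSpace (EuclideanHalfSpace (d + 1)) M]
  [IsManifold (𝓡∂ (d + 1)) ∞ M] [TopologicalSpace N]
  [ChartedSpace (EuclideanHalfSpace (d + 1)) N] [IsManifold (𝓡∂ (d + 1)) ∞ N]

/-- `P` is an isometry from an open subset of `M` to an open subset of `N`. -/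
structure IsPartialIsometry (gM : RiemannianMetricOn (𝓡∂ (d + 1)) M)
    (gN : RiemannianMetricOn (𝓡∂ (d + 1)) N) (P : OpenPartialHomeomorph M N) : Prop where
  contMDiffOn : ContMDiffOn (𝓡∂ (d + 1)) (𝓡∂ (d + 1)) ∞ P P.source
  contMDiffOn_symm : ContMDiffOn (𝓡∂ (d + 1)) (𝓡∂ (d + 1)) ∞ P.symm P.target
  inner_eq : ∀ x ∈ P.source, ∀ v w : TangentSpace (𝓡∂ (d + 1)) x,
    gN.inner (P x) (mfderiv (𝓡∂ (d + 1)) (𝓡∂ (d + 1)) P x v)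
      (mfderiv (𝓡∂ (d + 1)) (𝓡∂ (d + 1)) P x w) = gM.inner x v w

variable {gM : RiemannianMetricOn (𝓡∂ (d + 1)) M} {gN : RiemannianMetricOn (𝓡∂ (d + 1)) N}
  {P : OpenPartialHomeomorph M N}

namespace IsPartialIsometry

theorem contMDiffAt (hP : IsPartialIsometry gM gN P) {x : M} (hx : x ∈ P.source) :
    ContMDiffAt (𝓡∂ (d + 1)) (𝓡∂ (d + 1)) ∞ P x :=
  (hP.contMDiffOn x hx).contMDiffAt (P.open_source.mem_nhds hx)

theorem contMDiffAt_symm (hP : IsPartialIsometry gM gN P) {y : N} (hy : y ∈ P.target) :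
    ContMDiffAt (𝓡∂ (d + 1)) (𝓡∂ (d + 1)) ∞ P.symm y :=
  (hP.contMDiffOn_symm y hy).contMDiffAt (P.open_target.mem_nhds hy)

theorem symm (hP : IsPartialIsometry gM gN P) : IsPartialIsometry gN gM P.symm := by
  refine ⟨hP.contMDiffOn_symm, by simpa using hP.contMDiffOn, fun y hy v w => ?_⟩
  have hx : P.symm y ∈ P.source := P.map_target hy
  rw [← hP.inner_eq _ hx]
  have h1 : (fun z => P (P.symm z)) =ᶠ[𝓝 y] id := by
    filter_upwards [P.open_target.mem_nhds hy] with z hz using P.right_inv hz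
  have h2 := h1.mfderiv_eq (I := 𝓡∂ (d + 1)) (I' := 𝓡∂ (d + 1))
  have h3 := mfderiv_comp y ((hP.contMDiffAt hx).mdifferentiableAt (by simp))
    ((hP.contMDiffAt_symm hy).mdifferentiableAt (by simp))
  have h4 : (mfderiv (𝓡∂ (d + 1)) (𝓡∂ (d + 1)) P (P.symm y)).comp
      (mfderiv (𝓡∂ (d + 1)) (𝓡∂ (d + 1)) P.symm y) =
      ContinuousLinearMap.id ℝ (TangentSpace (𝓡∂ (d + 1)) y) := by
    rw [← mfderiv_id]
    exact h3.symm.trans h2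
  -- the fibres of the tangent bundle over `P (P.symm y)` and `y` are the same space
  have key : ∀ (p : N) (_ : p = y) (A : EuclideanSpace ℝ (Fin (d + 1)) →L[ℝ]
      EuclideanSpace ℝ (Fin (d + 1))) (_ : A = ContinuousLinearMap.id ℝ _),
      (gN.inner p : EuclideanSpace ℝ (Fin (d + 1)) →L[ℝ] EuclideanSpace ℝ (Fin (d + 1)) →L[ℝ] ℝ)
        (A v) (A w) = gN.inner y v w := by
    rintro _ rfl _ rfl
    rfl
  exact key _ (P.right_inv hy) _ h4

theorem trans_mem_maximalAtlas (hP : IsPartialIsometry gM gN P)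
    {e : OpenPartialHomeomorph N (EuclideanHalfSpace (d + 1))}
    (he : e ∈ IsManifold.maximalAtlas (𝓡∂ (d + 1)) ∞ N) :
    P.trans e ∈ IsManifold.maximalAtlas (𝓡∂ (d + 1)) ∞ M := by
  refine OpenPartialHomeomorph.mem_maximalAtlas_of_contMDiffOn _ ?_ ?_
  · exact (contMDiffOn_of_mem_maximalAtlas he).comp (hP.contMDiffOn.mono fun x hx => hx.1)
      fun x hx => hx.2
  · exact hP.contMDiffOn_symm.comp ((contMDiffOn_symm_of_mem_maximalAtlas he).mono
      fun x hx => hx.1) fun x hx => hx.2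

end IsPartialIsometry

/-- A partial isometry carries charts to charts with the same metric coefficients. -/
theorem IsPartialIsometry.gramMatrix_trans (hP : IsPartialIsometry gM gN P)
    {e : OpenPartialHomeomorph N (EuclideanHalfSpace (d + 1))}
    (he : e ∈ IsManifold.maximalAtlas (𝓡∂ (d + 1)) ∞ N) {y : EuclideanSpace ℝ (Fin (d + 1))}
    (hy : y ∈ ((P.trans e).extend (𝓡∂ (d + 1))).target) :
    gramMatrix gM (P.trans e) y = gramMatrix gN e y := by
  have hy1 := extend_trans_target_subset P e hy
  have hy2 := extend_symm_mem_target_of_mem_trans_target hy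
  have h1 := mfderiv_comp_mfderivWithin y
    ((hP.contMDiffAt_symm hy2).mdifferentiableAt (by simp))
    ((contMDiffWithinAt_extend_symm_range he hy1).mdifferentiableWithinAt (by simp))
    ((𝓡∂ (d + 1)).uniqueDiffOn y
      (e.extend_target_subset_range hy1)).uniqueMDiffWithinAt
  ext i j
  have h2 := hP.symm.inner_eq _ hy2
    (mfderivWithin 𝓘(ℝ, EuclideanSpace ℝ (Fin (d + 1))) (𝓡∂ (d + 1))
        (e.extend (𝓡∂ (d + 1))).symm (range (𝓡∂ (d + 1))) y (EuclideanSpace.single i 1))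
    (mfderivWithin 𝓘(ℝ, EuclideanSpace ℝ (Fin (d + 1))) (𝓡∂ (d + 1))
        (e.extend (𝓡∂ (d + 1))).symm (range (𝓡∂ (d + 1))) y (EuclideanSpace.single j 1))
  refine Eq.trans ?_ h2
  have h3 : ∀ v, mfderivWithin 𝓘(ℝ, EuclideanSpace ℝ (Fin (d + 1))) (𝓡∂ (d + 1))
        ((P.trans e).extend (𝓡∂ (d + 1))).symm (range (𝓡∂ (d + 1))) y v = _ :=
    fun v => congrArg (fun L : EuclideanSpace ℝ (Fin (d + 1)) →L[ℝ]
      EuclideanSpace ℝ (Fin (d + 1)) => L v) h1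
  exact congrArg₂ (fun v w : EuclideanSpace ℝ (Fin (d + 1)) =>
    (gM.inner (P.symm ((e.extend (𝓡∂ (d + 1))).symm y)) : EuclideanSpace ℝ (Fin (d + 1)) →L[ℝ]
      EuclideanSpace ℝ (Fin (d + 1)) →L[ℝ] ℝ) v w) (h3 _) (h3 _)

end LocalIsometry

section Measure

variable {A B : Type*} [MeasurableSpace A] [TopologicalSpace A] [OpensMeasurableSpace A]
  [TopologicalSpace B] [MeasurableSpace B] [BorelSpace B]

theorem measurableSet_inter_preimage_of_continuousOn {t : Set A} (ht : MeasurableSet t)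
    {k : A → B} (hk : ContinuousOn k t) {s : Set B} (hs : MeasurableSet s) :
    MeasurableSet (t ∩ k ⁻¹' s) := by
  have h := ht.subtype_image ((continuousOn_iff_continuous_domRestrict.1 hk).measurable hs)
  convert h using 1
  ext y
  simp [Set.domRestrict, and_comm]

/-- The measure of a set under the image of a measure with density under a parametrization `k`. -/
theorem map_withDensity_restrict_apply (μ : Measure A) {t : Set A} (ht : MeasurableSet t)
    {k : A → B} (hk : ContinuousOn k t) (f : A → ENNReal) {s : Set B} (hs : MeasurableSet s) :
    ((μ.restrict t).withDensity f).map k s = ∫⁻ y in t ∩ k ⁻¹' s, f y ∂μ := by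
  have h1 : AEMeasurable k ((μ.restrict t).withDensity f) :=
    (hk.aemeasurable ht).mono_ac (withDensity_absolutelyContinuous _ _)
  have hm := measurableSet_inter_preimage_of_continuousOn ht hk hs
  have h3 : (μ.restrict t).withDensity f (k ⁻¹' s) =
      (μ.restrict t).withDensity f (t ∩ k ⁻¹' s) := by
    refine measure_congr ?_
    have h4 : ∀ᵐ y ∂(μ.restrict t).withDensity f, y ∈ t :=
      (withDensity_absolutelyContinuous _ _).ae_le (ae_restrict_mem ht)
    filter_upwards [h4] with y hy
    exact propext ⟨fun h => ⟨hy, h⟩, fun h => h.2⟩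
  rw [Measure.map_apply_of_aemeasurable h1 hs, h3, withDensity_apply _ hm,
    Measure.restrict_restrict hm, inter_right_comm, inter_self]

end Measure

section GluedMeasure

variable {M N E : Type*} [TopologicalSpace M] [MeasurableSpace M] [BorelSpace M]
  [TopologicalSpace N] [MeasurableSpace N] [BorelSpace N] [TopologicalSpace E]

theorem measurableSet_source_inter_preimage (P : OpenPartialHomeomorph M N) {s : Set N}
    (hs : MeasurableSet s) : MeasurableSet (P.source ∩ P ⁻¹' s) :=
  measurableSet_inter_preimage_of_continuousOn P.open_source.measurableSet P.continuousOn hs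

theorem source_inter_preimage_target_inter (P : OpenPartialHomeomorph M N) (s : Set N) :
    P.source ∩ P ⁻¹' (P.target ∩ s) = P.source ∩ P ⁻¹' s := by
  ext x
  exact ⟨fun h => ⟨h.1, h.2.2⟩, fun h => ⟨h.1, P.map_source h.1, h.2⟩⟩

theorem target_inter_preimage_symm (P : OpenPartialHomeomorph M N) (s : Set N) :
    P.symm.source ∩ P.symm ⁻¹' (P.source ∩ P ⁻¹' s) = P.target ∩ s := by
  ext y
  constructor
  · rintro ⟨h1, _, h2⟩
    rw [mem_preimage, P.right_inv h1] at h2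
    exact ⟨h1, h2⟩
  · rintro ⟨h1, h2⟩
    refine ⟨h1, P.map_target h1, ?_⟩
    rwa [mem_preimage, P.right_inv h1]

theorem top_apply_of_nonempty {s : Set N} (hs : MeasurableSet s) (hne : s.Nonempty) :
    (⊤ : Measure N) s = ⊤ := by
  obtain ⟨x, hx⟩ := hne
  have h : ((⊤ : ENNReal) • Measure.dirac x) s ≤ (⊤ : Measure N) s :=
    (le_top (a := (⊤ : ENNReal) • Measure.dirac x)) s
  rw [Measure.smul_apply, Measure.dirac_apply' x hs, indicator_of_mem hx] at h
  simpa using h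

/-- The infimum that glues measures in the domains of charts is monotone under a partial
homeomorphism that does not increase the measures in the charts. -/
theorem iInf_add_top_restrict_apply_le {AM : Set (OpenPartialHomeomorph M E)}
    {AN : Set (OpenPartialHomeomorph N E)} {mM : OpenPartialHomeomorph M E → Measure M}
    {mN : OpenPartialHomeomorph N E → Measure N} (P : OpenPartialHomeomorph M N)
    (hA : ∀ e ∈ AN, P.trans e ∈ AM)
    (hle : ∀ e ∈ AN, ∀ s, MeasurableSet s → mM (P.trans e) (P.source ∩ P ⁻¹' s) ≤ mN e s)
    {s : Set N} (hs : MeasurableSet s) :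
    (⨅ e ∈ AM, (mM e + (⊤ : Measure M).restrict e.sourceᶜ)) (P.source ∩ P ⁻¹' s) ≤
      (⨅ e ∈ AN, (mN e + (⊤ : Measure N).restrict e.sourceᶜ)) s := by
  set μ := ⨅ e ∈ AM, (mM e + (⊤ : Measure M).restrict e.sourceᶜ)
  have hP : AEMeasurable P (μ.restrict P.source) :=
    P.continuousOn.aemeasurable P.open_source.measurableSet
  have hmap : ∀ t : Set N, MeasurableSet t →
      ((μ.restrict P.source).map P) t = μ (P.source ∩ P ⁻¹' t) := by
    intro t ht
    rw [Measure.map_apply_of_aemeasurable hP ht,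
      Measure.restrict_apply' P.open_source.measurableSet, inter_comm]
  rw [← hmap s hs]
  -- an infimum of measures is not computed set by set, so the image measure is compared with each
  -- member of the family
  refine (le_iInf₂ fun e he => Measure.le_iff.2 fun t ht => ?_ : (μ.restrict P.source).map P ≤
    ⨅ e ∈ AN, (mN e + (⊤ : Measure N).restrict e.sourceᶜ)) s
  have hm := measurableSet_source_inter_preimage P ht
  rw [hmap t ht]
  refine ((iInf₂_le _ (hA e he) : μ ≤ _) _).trans ?_
  rw [Measure.add_apply, Measure.add_apply]
  refine add_le_add (hle e he t ht) ?_
  rw [Measure.restrict_apply hm, Measure.restrict_apply ht]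
  rcases eq_empty_or_nonempty (P.source ∩ P ⁻¹' t ∩ (P.trans e).sourceᶜ) with h | ⟨x, hx, hx'⟩
  · rw [h, measure_empty]
    exact zero_le
  · rw [top_apply_of_nonempty (ht.inter e.open_source.measurableSet.compl)
      ⟨P x, hx.2, fun h => hx' ⟨hx.1, h⟩⟩]
    exact le_top

end GluedMeasure

section LocalIsometry

variable {d : ℕ} {M N : Type*} [TopologicalSpace M] [ChartedSpace (EuclideanHalfSpace (d + 1)) M]
  [IsManifold (𝓡∂ (d + 1)) ∞ M] [TopologicalSpace N]
  [ChartedSpace (EuclideanHalfSpace (d + 1)) N] [IsManifold (𝓡∂ (d + 1)) ∞ N]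
  {gM : RiemannianMetricOn (𝓡∂ (d + 1)) M} {gN : RiemannianMetricOn (𝓡∂ (d + 1)) N}
  {P : OpenPartialHomeomorph M N}

theorem measurableSet_extend_target (e : OpenPartialHomeomorph N (EuclideanHalfSpace (d + 1))) :
    MeasurableSet (e.extend (𝓡∂ (d + 1))).target := by
  rw [OpenPartialHomeomorph.extend_target]
  exact (e.open_target.preimage (𝓡∂ (d + 1)).continuous_symm).measurableSet.inter
    (𝓡∂ (d + 1)).isClosed_range.measurableSet

theorem continuous_boundaryInclusion : Continuous (boundaryInclusion (d := d)) := by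
  unfold boundaryInclusion
  refine (PiLp.continuous_toLp 2 _).comp (continuous_pi fun i => ?_)
  refine Fin.cases ?_ (fun j => ?_) i
  · simpa using continuous_const
  · simpa using PiLp.continuous_apply 2 _ j

theorem continuousOn_extend_symm_boundaryInclusion
    (e : OpenPartialHomeomorph N (EuclideanHalfSpace (d + 1))) :
    ContinuousOn (fun z => (e.extend (𝓡∂ (d + 1))).symm (boundaryInclusion z))
      (boundaryInclusion ⁻¹' (e.extend (𝓡∂ (d + 1))).target) :=
  e.continuousOn_extend_symm.comp continuous_boundaryInclusion.continuousOn fun _ h => h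

theorem chartVolume_apply (g : RiemannianMetricOn (𝓡∂ (d + 1)) N)
    (e : OpenPartialHomeomorph N (EuclideanHalfSpace (d + 1))) {s : Set N}
    (hs : MeasurableSet[borel N] s) :
    chartVolume g e s =
      ∫⁻ y in (e.extend (𝓡∂ (d + 1))).target ∩ (e.extend (𝓡∂ (d + 1))).symm ⁻¹' s,
        ENNReal.ofReal √(gramMatrix g e y).det := by
  let _ : MeasurableSpace N := borel N
  have : BorelSpace N := ⟨rfl⟩
  exact map_withDensity_restrict_apply _ (measurableSet_extend_target e)
    (e.continuousOn_extend_symm) _ hs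

theorem chartBoundaryMeasure_apply (g : RiemannianMetricOn (𝓡∂ (d + 1)) N)
    (e : OpenPartialHomeomorph N (EuclideanHalfSpace (d + 1))) {s : Set N}
    (hs : MeasurableSet[borel N] s) :
    chartBoundaryMeasure g e s =
      ∫⁻ z in (boundaryInclusion ⁻¹' (e.extend (𝓡∂ (d + 1))).target) ∩
          (fun z => (e.extend (𝓡∂ (d + 1))).symm (boundaryInclusion z)) ⁻¹' s,
        ENNReal.ofReal √((gramMatrix g e (boundaryInclusion z)).submatrix Fin.succ Fin.succ).det :=
  by
  let _ : MeasurableSpace N := borel N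
  have : BorelSpace N := ⟨rfl⟩
  exact map_withDensity_restrict_apply _
    (continuous_boundaryInclusion.measurable (measurableSet_extend_target e))
    (continuousOn_extend_symm_boundaryInclusion e) _ hs

theorem extend_symm_mem_of_mem_trans {e : OpenPartialHomeomorph N (EuclideanHalfSpace (d + 1))}
    {y : EuclideanSpace ℝ (Fin (d + 1))} (hy : y ∈ ((P.trans e).extend (𝓡∂ (d + 1))).target)
    {s : Set N} (hs : ((P.trans e).extend (𝓡∂ (d + 1))).symm y ∈ P.source ∩ P ⁻¹' s) :
    (e.extend (𝓡∂ (d + 1))).symm y ∈ s := by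
  have h := hs.2
  rwa [mem_preimage, extend_trans_symm_apply,
    P.right_inv (extend_symm_mem_target_of_mem_trans_target hy)] at h

namespace IsPartialIsometry

theorem riemannianVolume_le (hP : IsPartialIsometry gM gN P) {s : Set N}
    (hs : MeasurableSet[borel N] s) :
    riemannianVolume gM (P.source ∩ P ⁻¹' s) ≤ riemannianVolume gN s := by
  let _ : MeasurableSpace M := borel M
  have : BorelSpace M := ⟨rfl⟩
  let _ : MeasurableSpace N := borel N
  have : BorelSpace N := ⟨rfl⟩
  refine iInf_add_top_restrict_apply_le P (fun e he => hP.trans_mem_maximalAtlas he)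
    (fun e he s hs => ?_) hs
  have hm := measurableSet_source_inter_preimage P hs
  rw [chartVolume_apply gM _ hm, chartVolume_apply gN _ hs]
  rw [setLIntegral_congr_fun (g := fun y => ENNReal.ofReal √(gramMatrix gN e y).det)
    (measurableSet_inter_preimage_of_continuousOn (measurableSet_extend_target _)
      (P.trans e).continuousOn_extend_symm hm)
    fun y hy => by simp only [hP.gramMatrix_trans he hy.1]]
  exact lintegral_mono_set fun y hy =>
    ⟨extend_trans_target_subset P e hy.1, extend_symm_mem_of_mem_trans hy.1 hy.2⟩

theorem boundaryMeasure_le (hP : IsPartialIsometry gM gN P) {s : Set N}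
    (hs : MeasurableSet[borel N] s) :
    boundaryMeasure gM (P.source ∩ P ⁻¹' s) ≤ boundaryMeasure gN s := by
  let _ : MeasurableSpace M := borel M
  have : BorelSpace M := ⟨rfl⟩
  let _ : MeasurableSpace N := borel N
  have : BorelSpace N := ⟨rfl⟩
  refine iInf_add_top_restrict_apply_le P (fun e he => hP.trans_mem_maximalAtlas he)
    (fun e he s hs => ?_) hs
  have hm := measurableSet_source_inter_preimage P hs
  rw [chartBoundaryMeasure_apply gM _ hm, chartBoundaryMeasure_apply gN _ hs]
  rw [setLIntegral_congr_fun (g := fun z => ENNReal.ofReal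
      √((gramMatrix gN e (boundaryInclusion z)).submatrix Fin.succ Fin.succ).det)
    (measurableSet_inter_preimage_of_continuousOn
      (continuous_boundaryInclusion.measurable (measurableSet_extend_target _))
      (continuousOn_extend_symm_boundaryInclusion (P.trans e)) hm)
    fun y hy => by simp only [hP.gramMatrix_trans he hy.1]]
  exact lintegral_mono_set fun y hy =>
    ⟨extend_trans_target_subset P e hy.1, extend_symm_mem_of_mem_trans hy.1 hy.2⟩

theorem riemannianVolume_preimage (hP : IsPartialIsometry gM gN P) {s : Set N}
    (hs : MeasurableSet[borel N] s) :
    riemannianVolume gM (P.source ∩ P ⁻¹' s) = riemannianVolume gN (P.target ∩ s) := by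
  let _ : MeasurableSpace M := borel M
  have : BorelSpace M := ⟨rfl⟩
  let _ : MeasurableSpace N := borel N
  have : BorelSpace N := ⟨rfl⟩
  apply le_antisymm
  · have h := hP.riemannianVolume_le (P.open_target.measurableSet.inter hs)
    rwa [source_inter_preimage_target_inter] at h
  · have h := hP.symm.riemannianVolume_le (measurableSet_source_inter_preimage P hs)
    rwa [target_inter_preimage_symm] at h

theorem boundaryMeasure_preimage (hP : IsPartialIsometry gM gN P) {s : Set N}
    (hs : MeasurableSet[borel N] s) :
    boundaryMeasure gM (P.source ∩ P ⁻¹' s) = boundaryMeasure gN (P.target ∩ s) := by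
  let _ : MeasurableSpace M := borel M
  have : BorelSpace M := ⟨rfl⟩
  let _ : MeasurableSpace N := borel N
  have : BorelSpace N := ⟨rfl⟩
  apply le_antisymm
  · have h := hP.boundaryMeasure_le (P.open_target.measurableSet.inter hs)
    rwa [source_inter_preimage_target_inter] at h
  · have h := hP.symm.boundaryMeasure_le (measurableSet_source_inter_preimage P hs)
    rwa [target_inter_preimage_symm] at h

end IsPartialIsometry

end LocalIsometry

/-! ### Finiteness of the volume and of the boundary measure -/

section Finite

variable {d : ℕ} {N : Type*} [TopologicalSpace N] [ChartedSpace (EuclideanHalfSpace (d + 1)) N]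
  [IsManifold (𝓡∂ (d + 1)) ∞ N] (g : RiemannianMetricOn (𝓡∂ (d + 1)) N)

theorem uniqueDiffOn_extend_target (e : OpenPartialHomeomorph N (EuclideanHalfSpace (d + 1))) :
    UniqueDiffOn ℝ (e.extend (𝓡∂ (d + 1))).target := by
  rw [OpenPartialHomeomorph.extend_target]
  exact (𝓡∂ (d + 1)).uniqueDiffOn_preimage e.open_target

theorem contMDiff_const_tangentSection {E : Type*} [NormedAddCommGroup E] [NormedSpace ℝ E]
    (v : E) : ContMDiff 𝓘(ℝ, E) 𝓘(ℝ, E).tangent ∞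
      (fun y : E => Bundle.TotalSpace.mk' E (E := (TangentSpace 𝓘(ℝ, E) : E → Type _)) y v) := by
  exact contMDiff_vectorSpace_iff_contDiff.2 (contDiff_const (c := v))

theorem continuousOn_gramMatrix_apply {e : OpenPartialHomeomorph N (EuclideanHalfSpace (d + 1))}
    (he : e ∈ IsManifold.maximalAtlas (𝓡∂ (d + 1)) ∞ N) (i j : Fin (d + 1)) :
    ContinuousOn (fun y => gramMatrix g e y i j) (e.extend (𝓡∂ (d + 1))).target := by
  set T := (e.extend (𝓡∂ (d + 1))).target
  have hsymm : ContMDiffOn 𝓘(ℝ, EuclideanSpace ℝ (Fin (d + 1))) (𝓡∂ (d + 1)) ∞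
      (e.extend (𝓡∂ (d + 1))).symm T :=
    fun y hy => (contMDiffWithinAt_extend_symm_range he hy).mono (e.extend_target_subset_range)
  have hsec : ∀ v : EuclideanSpace ℝ (Fin (d + 1)),
      ContMDiffOn 𝓘(ℝ, EuclideanSpace ℝ (Fin (d + 1))) (𝓡∂ (d + 1)).tangent ∞
      (fun y => Bundle.TotalSpace.mk' (EuclideanSpace ℝ (Fin (d + 1)))
        (E := (TangentSpace (𝓡∂ (d + 1)) : N → Type _)) ((e.extend (𝓡∂ (d + 1))).symm y)
        (mfderivWithin 𝓘(ℝ, EuclideanSpace ℝ (Fin (d + 1))) (𝓡∂ (d + 1))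
          (e.extend (𝓡∂ (d + 1))).symm (range (𝓡∂ (d + 1))) y v)) T := by
    intro v
    have h1 := (hsymm.contMDiffOn_tangentMapWithin (m := ∞) (by simp)
      (uniqueDiffOn_extend_target e).uniqueMDiffOn).comp
        ((contMDiff_const_tangentSection v).contMDiffOn (s := T)) (fun y hy => hy)
    refine h1.congr fun y hy => ?_
    have h2 : mfderivWithin 𝓘(ℝ, EuclideanSpace ℝ (Fin (d + 1))) (𝓡∂ (d + 1))
        (e.extend (𝓡∂ (d + 1))).symm T y =
        mfderivWithin 𝓘(ℝ, EuclideanSpace ℝ (Fin (d + 1))) (𝓡∂ (d + 1))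
        (e.extend (𝓡∂ (d + 1))).symm (range (𝓡∂ (d + 1))) y :=
      mfderivWithin_subset e.extend_target_subset_range
        ((uniqueDiffOn_extend_target e).uniqueMDiffOn y hy)
        ((contMDiffWithinAt_extend_symm_range he hy).mdifferentiableWithinAt (by simp))
    simp only [Function.comp_apply, tangentMapWithin]
    rw [h2]
  have h := ContMDiffOn.clm_bundle_apply₂ (F₁ := EuclideanSpace ℝ (Fin (d + 1)))
    (F₂ := EuclideanSpace ℝ (Fin (d + 1))) (F₃ := ℝ) (E₃ := fun _ : N => ℝ)
    (g.contMDiff.comp_contMDiffOn hsymm) (hsec (EuclideanSpace.single i 1))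
    (hsec (EuclideanSpace.single j 1))
  intro y hy
  have h3 := h y hy
  rw [Bundle.contMDiffWithinAt_totalSpace] at h3
  exact h3.2.continuousWithinAt

theorem norm_le_norm_boundaryInclusion (z : EuclideanSpace ℝ (Fin d)) :
    ‖z‖ ≤ ‖boundaryInclusion z‖ := by
  rw [EuclideanSpace.norm_eq, EuclideanSpace.norm_eq]
  apply Real.sqrt_le_sqrt
  rw [Fin.sum_univ_succ]
  simp [boundaryInclusion]

theorem setLIntegral_lt_top_of_le_of_isBounded {A : Type*} [PseudoMetricSpace A] [ProperSpace A]
    [MeasurableSpace A] {μ : Measure A} [IsFiniteMeasureOnCompacts μ] {s : Set A}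
    (hs : MeasurableSet s) (hb : Bornology.IsBounded s) {f : A → ENNReal} {C : ENNReal} (hC : C < ⊤)
    (hf : ∀ y ∈ s, f y ≤ C) : ∫⁻ y in s, f y ∂μ < ⊤ := by
  refine lt_of_le_of_lt (setLIntegral_mono' hs hf) ?_
  rw [setLIntegral_const]
  exact ENNReal.mul_lt_top hC hb.measure_lt_top

/-- Both measures are bounded by the measures in a chart, whose densities are locally bounded. -/
theorem exists_isOpen_measure_lt_top (x : N) : ∃ U : Set N, IsOpen U ∧ x ∈ U ∧
    riemannianVolume g U < ⊤ ∧ boundaryMeasure g U < ⊤ := by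
  let _ : MeasurableSpace N := borel N
  have : BorelSpace N := ⟨rfl⟩
  set e := chartAt (EuclideanHalfSpace (d + 1)) x
  have he : e ∈ IsManifold.maximalAtlas (𝓡∂ (d + 1)) ∞ N := IsManifold.chart_mem_maximalAtlas x
  set T := (e.extend (𝓡∂ (d + 1))).target
  set y₀ := e.extend (𝓡∂ (d + 1)) x
  have hx : x ∈ (e.extend (𝓡∂ (d + 1))).source := by
    rw [OpenPartialHomeomorph.extend_source]
    exact mem_chart_source _ x
  have hy₀ : y₀ ∈ T := (e.extend (𝓡∂ (d + 1))).map_source hx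
  have hgram : ContinuousWithinAt (fun y => gramMatrix g e y) T y₀ :=
    continuousWithinAt_pi.2 fun i => continuousWithinAt_pi.2 fun j =>
      continuousOn_gramMatrix_apply g he i j y₀ hy₀
  have h1 : ContinuousWithinAt (fun y => ENNReal.ofReal √(gramMatrix g e y).det) T y₀ :=
    (ENNReal.continuous_ofReal.comp
      (Real.continuous_sqrt.comp (continuous_id.matrix_det))).continuousAt.comp_continuousWithinAt
      hgram
  have h2 : ContinuousWithinAt (fun y => ENNReal.ofReal
      √((gramMatrix g e y).submatrix Fin.succ Fin.succ).det) T y₀ :=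
    (ENNReal.continuous_ofReal.comp (Real.continuous_sqrt.comp
      ((continuous_id.matrix_submatrix _ _).matrix_det))).continuousAt.comp_continuousWithinAt
      hgram
  obtain ⟨C₁, hC₁, hC₁'⟩ := exists_between (ENNReal.ofReal_lt_top (r := √(gramMatrix g e y₀).det))
  obtain ⟨C₂, hC₂, hC₂'⟩ := exists_between (ENNReal.ofReal_lt_top
    (r := √((gramMatrix g e y₀).submatrix Fin.succ Fin.succ).det))
  have h3 := (h1.eventually (gt_mem_nhds hC₁)).and (h2.eventually (gt_mem_nhds hC₂))
  rw [eventually_nhdsWithin_iff] at h3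
  have h4 := h3.and (Metric.ball_mem_nhds y₀ one_pos)
  obtain ⟨W, hW, hWo, hyW⟩ := eventually_nhds_iff.1 h4
  have hUo : IsOpen (e.source ∩ e.extend (𝓡∂ (d + 1)) ⁻¹' W) := by
    have := (e.continuousOn_extend (I := 𝓡∂ (d + 1))).isOpen_inter_preimage
      (by rw [OpenPartialHomeomorph.extend_source]; exact e.open_source) hWo
    rwa [OpenPartialHomeomorph.extend_source] at this
  have hmem : ∀ y ∈ T, (e.extend (𝓡∂ (d + 1))).symm y ∈
      e.source ∩ e.extend (𝓡∂ (d + 1)) ⁻¹' W →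
      (y ∈ T → ENNReal.ofReal √(gramMatrix g e y).det < C₁ ∧ ENNReal.ofReal
        √((gramMatrix g e y).submatrix Fin.succ Fin.succ).det < C₂) ∧ y ∈ Metric.ball y₀ 1 := by
    intro y hy hyU
    have h5 := hyU.2
    rw [mem_preimage, (e.extend (𝓡∂ (d + 1))).right_inv hy] at h5
    exact hW y h5
  refine ⟨_, hUo, ⟨mem_chart_source _ x, hyW⟩, ?_, ?_⟩
  · refine lt_of_le_of_lt ((iInf₂_le e he : riemannianVolume g ≤ _) _) ?_
    rw [Measure.add_apply, Measure.restrict_apply hUo.measurableSet, inter_right_comm,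
      inter_compl_self, empty_inter, measure_empty, add_zero, chartVolume_apply g e
      hUo.measurableSet]
    refine setLIntegral_lt_top_of_le_of_isBounded
      (measurableSet_inter_preimage_of_continuousOn (measurableSet_extend_target e)
        e.continuousOn_extend_symm hUo.measurableSet)
      (Metric.isBounded_ball.subset fun y hy => (hmem y hy.1 hy.2).2) hC₁' fun y hy => ?_
    exact ((hmem y hy.1 hy.2).1 hy.1).1.le
  · refine lt_of_le_of_lt ((iInf₂_le e he : boundaryMeasure g ≤ _) _) ?_
    rw [Measure.add_apply, Measure.restrict_apply hUo.measurableSet, inter_right_comm,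
      inter_compl_self, empty_inter, measure_empty, add_zero, chartBoundaryMeasure_apply g e
      hUo.measurableSet]
    refine setLIntegral_lt_top_of_le_of_isBounded
      (measurableSet_inter_preimage_of_continuousOn
        (continuous_boundaryInclusion.measurable (measurableSet_extend_target e))
        (continuousOn_extend_symm_boundaryInclusion e) hUo.measurableSet)
      ((Metric.isBounded_closedBall (x := 0) (r := ‖y₀‖ + 1)).subset fun z hz => ?_) hC₂'
      fun z hz => ((hmem _ hz.1 hz.2).1 hz.1).2.le
    -- the domain of integration is bounded, as `boundaryInclusion` does not decrease norms
    rw [mem_closedBall_zero_iff]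
    have h5 := (hmem _ hz.1 hz.2).2
    rw [Metric.mem_ball, dist_eq_norm] at h5
    calc ‖z‖ ≤ ‖boundaryInclusion z‖ := norm_le_norm_boundaryInclusion z
      _ ≤ ‖boundaryInclusion z - y₀‖ + ‖y₀‖ := norm_le_norm_sub_add _ _
      _ ≤ ‖y₀‖ + 1 := by linarith

theorem measure_univ_lt_top [CompactSpace N] :
    riemannianVolume g univ < ⊤ ∧ boundaryMeasure g univ < ⊤ := by
  let _ : MeasurableSpace N := borel N
  choose U hUo hxU h1 h2 using exists_isOpen_measure_lt_top g
  obtain ⟨t, ht⟩ := isCompact_univ.elim_finite_subcover U hUo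
    fun x _ => mem_iUnion.2 ⟨x, hxU x⟩
  exact ⟨(measure_mono ht).trans_lt (measure_biUnion_lt_top t.finite_toSet fun x _ => h1 x),
    (measure_mono ht).trans_lt (measure_biUnion_lt_top t.finite_toSet fun x _ => h2 x)⟩

instance isFiniteMeasure_riemannianVolume [CompactSpace N] :
    @IsFiniteMeasure N (borel N) (riemannianVolume g) :=
  @IsFiniteMeasure.mk N (borel N) _ (measure_univ_lt_top g).1

instance isFiniteMeasure_boundaryMeasure [CompactSpace N] :
    @IsFiniteMeasure N (borel N) (boundaryMeasure g) :=
  @IsFiniteMeasure.mk N (borel N) _ (measure_univ_lt_top g).2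

end Finite

/-! ### The energy density -/

section Energy

variable {d : ℕ} {N : Type*} [TopologicalSpace N] [ChartedSpace (EuclideanHalfSpace (d + 1)) N]
  [IsManifold (𝓡∂ (d + 1)) ∞ N] (g : RiemannianMetricOn (𝓡∂ (d + 1)) N)

theorem eq_of_inner_eq {x : N} {w w' : TangentSpace (𝓡∂ (d + 1)) x}
    (h : ∀ v, g.inner x w v = g.inner x w' v) : w = w' := by
  by_contra hne
  have h1 := g.pos x (w - w') (sub_ne_zero.2 hne)
  have h2 : g.inner x (w - w') (w - w') = g.inner x w (w - w') - g.inner x w' (w - w') :=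
    congrArg (fun L : TangentSpace (𝓡∂ (d + 1)) x →L[ℝ] ℝ => L (w - w'))
      ((g.inner x).map_sub w w')
  rw [h2, h, sub_self] at h1
  exact lt_irrefl _ h1

theorem mdifferentiableAt_smoothMap (φ : C^∞⟮𝓡∂ (d + 1), N; 𝓘(ℝ, ℝ), ℝ⟯) (x : N) :
    MDifferentiableAt (𝓡∂ (d + 1)) 𝓘(ℝ, ℝ) φ x :=
  φ.contMDiff.mdifferentiable (by simp) x

theorem riemannianGradient_add (φ ψ : C^∞⟮𝓡∂ (d + 1), N; 𝓘(ℝ, ℝ), ℝ⟯) (x : N) :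
    riemannianGradient g (φ + ψ) x = riemannianGradient g φ x + riemannianGradient g ψ x := by
  refine eq_of_inner_eq g fun v => ?_
  rw [inner_riemannianGradient, map_add]
  refine Eq.trans ?_ (congrArg₂ (· + ·) (inner_riemannianGradient g φ x v).symm
    (inner_riemannianGradient g ψ x v).symm)
  have h := mfderiv_add (mdifferentiableAt_smoothMap φ x) (mdifferentiableAt_smoothMap ψ x)
  exact congrArg (fun L : TangentSpace (𝓡∂ (d + 1)) x →L[ℝ] ℝ => L v) h

theorem riemannianGradient_smul (c : ℝ) (φ : C^∞⟮𝓡∂ (d + 1), N; 𝓘(ℝ, ℝ), ℝ⟯) (x : N) :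
    riemannianGradient g (c • φ) x = c • riemannianGradient g φ x := by
  refine eq_of_inner_eq g fun v => ?_
  rw [inner_riemannianGradient, map_smul]
  refine Eq.trans ?_ (congrArg (c • ·) (inner_riemannianGradient g φ x v).symm)
  have h := const_smul_mfderiv (mdifferentiableAt_smoothMap φ x) c
  exact congrArg (fun L : TangentSpace (𝓡∂ (d + 1)) x →L[ℝ] ℝ => L v) h

theorem riemannianGradient_sub (φ ψ : C^∞⟮𝓡∂ (d + 1), N; 𝓘(ℝ, ℝ), ℝ⟯) (x : N) :
    riemannianGradient g (φ - ψ) x = riemannianGradient g φ x - riemannianGradient g ψ x := by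
  have h : φ - ψ = φ + (-1 : ℝ) • ψ := by rw [neg_one_smul, sub_eq_add_neg]
  rw [h, riemannianGradient_add, riemannianGradient_smul, neg_one_smul, sub_eq_add_neg]

/-- The function `⟨∇φ, ∇ψ⟩`. -/
def energyDensity (φ ψ : C^∞⟮𝓡∂ (d + 1), N; 𝓘(ℝ, ℝ), ℝ⟯) (x : N) : ℝ :=
  g.inner x (riemannianGradient g φ x) (riemannianGradient g ψ x)

theorem energyDensity_eq_mfderiv (φ ψ : C^∞⟮𝓡∂ (d + 1), N; 𝓘(ℝ, ℝ), ℝ⟯) (x : N) :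
    energyDensity g φ ψ x = mfderiv (𝓡∂ (d + 1)) 𝓘(ℝ, ℝ) φ x (riemannianGradient g ψ x) :=
  inner_riemannianGradient g φ x _

theorem energyDensity_comm (φ ψ : C^∞⟮𝓡∂ (d + 1), N; 𝓘(ℝ, ℝ), ℝ⟯) (x : N) :
    energyDensity g φ ψ x = energyDensity g ψ φ x := g.symm _ _ _

theorem energyDensity_add_right (φ ψ ψ' : C^∞⟮𝓡∂ (d + 1), N; 𝓘(ℝ, ℝ), ℝ⟯) (x : N) :
    energyDensity g φ (ψ + ψ') x = energyDensity g φ ψ x + energyDensity g φ ψ' x := by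
  unfold energyDensity
  rw [riemannianGradient_add, map_add]

theorem energyDensity_smul_right (c : ℝ) (φ ψ : C^∞⟮𝓡∂ (d + 1), N; 𝓘(ℝ, ℝ), ℝ⟯) (x : N) :
    energyDensity g φ (c • ψ) x = c * energyDensity g φ ψ x := by
  unfold energyDensity
  rw [riemannianGradient_smul, map_smul, smul_eq_mul]

theorem energyDensity_add_left (φ φ' ψ : C^∞⟮𝓡∂ (d + 1), N; 𝓘(ℝ, ℝ), ℝ⟯) (x : N) :
    energyDensity g (φ + φ') ψ x = energyDensity g φ ψ x + energyDensity g φ' ψ x := by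
  simp only [energyDensity_comm g _ ψ, energyDensity_add_right]

theorem energyDensity_smul_left (c : ℝ) (φ ψ : C^∞⟮𝓡∂ (d + 1), N; 𝓘(ℝ, ℝ), ℝ⟯) (x : N) :
    energyDensity g (c • φ) ψ x = c * energyDensity g φ ψ x := by
  simp only [energyDensity_comm g _ ψ, energyDensity_smul_right]

theorem energyDensity_self_nonneg (φ : C^∞⟮𝓡∂ (d + 1), N; 𝓘(ℝ, ℝ), ℝ⟯) (x : N) :
    0 ≤ energyDensity g φ φ x := by
  unfold energyDensity
  by_cases h : riemannianGradient g φ x = 0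
  · rw [h]
    simp
  · exact (g.pos x _ h).le

/-- In a trivialization of the tangent bundle, the gradient is the image of the differential under
the inverse of the matrix of the metric, hence continuous. -/
theorem continuous_energyDensity (φ ψ : C^∞⟮𝓡∂ (d + 1), N; 𝓘(ℝ, ℝ), ℝ⟯) :
    Continuous (energyDensity g φ ψ) := by
  rw [continuous_iff_continuousAt]
  intro x
  set E := EuclideanSpace ℝ (Fin (d + 1))
  let e := trivializationAt E (TangentSpace (𝓡∂ (d + 1)) : N → Type _) x
  have hx : x ∈ e.baseSet := FiberBundle.mem_baseSet_trivializationAt' x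
  have hsec : ∀ v : E, ContMDiffAt (𝓡∂ (d + 1)) (𝓡∂ (d + 1)).tangent ∞
      (fun z => Bundle.TotalSpace.mk' E (E := (TangentSpace (𝓡∂ (d + 1)) : N → Type _)) z
        (e.symmL ℝ z v)) x := by
    intro v
    exact ContMDiffAt.clm_bundle_apply (F₁ := E) (F₂ := E) (v := fun _ => v)
      (E₁ := fun _ : N => E) (E₂ := (TangentSpace (𝓡∂ (d + 1)) : N → Type _))
      (e.contMDiffAt_symmL (IB := 𝓡∂ (d + 1)) (n := ∞) hx)
      (by
        rw [Bundle.contMDiffAt_section]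
        exact contMDiffAt_const)
  -- the metric and the differentials of functions, read in the trivialization
  let L : N → E →L[ℝ] E →L[ℝ] ℝ := fun z =>
    (ContinuousLinearMap.precomp ℝ (e.symmL ℝ z)).comp ((g.inner z).comp (e.symmL ℝ z))
  have hL : ContMDiffAt (𝓡∂ (d + 1)) 𝓘(ℝ, E →L[ℝ] E →L[ℝ] ℝ) ∞ L x := by
    refine contMDiffAt_clm_of_apply fun v => contMDiffAt_clm_of_apply fun w => ?_
    have h := ContMDiffAt.clm_bundle_apply₂ (F₁ := E) (F₂ := E) (F₃ := ℝ)
      (E₃ := fun _ : N => ℝ) g.contMDiff.contMDiffAt (hsec v) (hsec w)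
    rw [Bundle.contMDiffAt_totalSpace] at h
    exact h.2
  let l : C^∞⟮𝓡∂ (d + 1), N; 𝓘(ℝ, ℝ), ℝ⟯ → N → E →L[ℝ] ℝ := fun φ z =>
    (mfderiv (𝓡∂ (d + 1)) 𝓘(ℝ, ℝ) φ z : TangentSpace (𝓡∂ (d + 1)) z →L[ℝ] ℝ).comp (e.symmL ℝ z)
  have hl : ∀ φ, ContMDiffAt (𝓡∂ (d + 1)) 𝓘(ℝ, E →L[ℝ] ℝ) ∞ (l φ) x := by
    intro φ
    refine contMDiffAt_clm_of_apply fun v => ?_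
    have h := ((φ.contMDiff.contMDiff_tangentMap (m := ∞) (by simp)).contMDiffAt).comp x (hsec v)
    rw [Bundle.contMDiffAt_totalSpace] at h
    have h2 := h.2
    simp only [trivializationAt_model_space_apply] at h2
    exact h2
  have hinj : ∀ z ∈ e.baseSet, ∀ v, L z v = 0 → v = 0 := by
    intro z hz v hv
    by_contra hne
    have h1 : e.symmL ℝ z v ≠ 0 := by
      intro h0
      apply hne
      have := e.continuousLinearMapAt_symmL (R := ℝ) hz v
      rw [h0, map_zero] at this
      exact this.symm
    have h2 := g.pos z _ h1
    have h3 : L z v v = 0 := by rw [hv]; rfl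
    exact h2.ne' h3
  have hinv : ∀ z ∈ e.baseSet, (L z).IsInvertible := by
    intro z hz
    have hfr : Module.finrank ℝ E = Module.finrank ℝ (E →L[ℝ] ℝ) := by
      rw [← Subspace.dual_finrank_eq (K := ℝ) (V := E)]
      exact (LinearMap.toContinuousLinearMap (𝕜 := ℝ) (E := E) (F' := ℝ)).finrank_eq
    exact ⟨(LinearEquiv.ofInjectiveOfFinrankEq (L z).toLinearMap
      ((injective_iff_map_eq_zero _).2 (hinj z hz)) hfr).toContinuousLinearEquiv, rfl⟩
  have hcont : ContinuousAt (fun z => l φ z ((L z).inverse (l ψ z))) x := by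
    refine (hl φ).continuousAt.clm_apply (ContinuousAt.clm_apply ?_ (hl ψ).continuousAt)
    exact ((hinv x hx).contDiffAt_map_inverse (n := 0)).continuousAt.comp hL.continuousAt
  refine hcont.congr ?_
  filter_upwards [e.open_baseSet.mem_nhds hx] with z hz
  have h1 : (L z).inverse (l ψ z) = e.continuousLinearMapAt ℝ z (riemannianGradient g ψ z) := by
    have h2 : L z (e.continuousLinearMapAt ℝ z (riemannianGradient g ψ z)) = l ψ z := by
      ext v
      have h3 : e.symmL ℝ z (e.continuousLinearMapAt ℝ z (riemannianGradient g ψ z)) =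
        riemannianGradient g ψ z := e.symmL_continuousLinearMapAt hz _
      change g.inner z (e.symmL ℝ z (e.continuousLinearMapAt ℝ z (riemannianGradient g ψ z)))
        (e.symmL ℝ z v) = mfderiv (𝓡∂ (d + 1)) 𝓘(ℝ, ℝ) ψ z (e.symmL ℝ z v)
      rw [h3, inner_riemannianGradient]
    rw [← h2]
    exact (hinv z hz).inverse_apply_self _
  rw [h1, energyDensity_eq_mfderiv]
  change mfderiv (𝓡∂ (d + 1)) 𝓘(ℝ, ℝ) φ z (e.symmL ℝ z (e.continuousLinearMapAt ℝ z
    (riemannianGradient g ψ z))) = _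
  rw [e.symmL_continuousLinearMapAt hz]

end Energy

/-! ### Composition with a map that preserves measure up to a factor -/

section Pullback

variable {A B D : Type*} {mA : MeasurableSpace A} {mB : MeasurableSpace B} {mD : MeasurableSpace D}

/-- The image of `μ` under `p` is `c ν`. -/
structure MeasureScaling (p : A → B) (c : ℝ) (μ : Measure A) (ν : Measure B) : Prop where
  measurable : Measurable p
  pos : 0 < c
  map_eq : μ.map p = ENNReal.ofReal c • ν

namespace MeasureScaling

variable {p : A → B} {c : ℝ} {μ : Measure A} {ν : Measure B}

theorem absolutelyContinuous (h : MeasureScaling p c μ ν) : ν ≪ μ.map p := by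
  rw [h.map_eq]
  exact Measure.absolutelyContinuous_smul (by simpa using h.pos)

theorem quasiMeasurePreserving (h : MeasureScaling p c μ ν) :
    Measure.QuasiMeasurePreserving p μ ν :=
  ⟨h.measurable, by
    rw [h.map_eq]
    exact Measure.smul_absolutelyContinuous⟩

theorem memLp_comp_iff (h : MeasureScaling p c μ ν) {F : B → ℝ} (hF : AEStronglyMeasurable F ν)
    {q : ENNReal} : MemLp (F ∘ p) q μ ↔ MemLp F q ν := by
  rw [← memLp_map_measure_iff (hF.mono_ac h.quasiMeasurePreserving.absolutelyContinuous)
    h.measurable.aemeasurable, h.map_eq]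
  refine ⟨fun h1 => ?_, fun h1 => h1.smul_measure ENNReal.ofReal_ne_top⟩
  have h2 := h1.smul_measure (c := (ENNReal.ofReal c)⁻¹) (by simpa using h.pos)
  rwa [smul_smul, ENNReal.inv_mul_cancel (by simpa using h.pos) ENNReal.ofReal_ne_top,
    one_smul] at h2

theorem integral_comp (h : MeasureScaling p c μ ν) {F : B → ℝ} (hF : AEStronglyMeasurable F ν) :
    ∫ x, F (p x) ∂μ = c * ∫ y, F y ∂ν := by
  rw [← integral_map h.measurable.aemeasurable
    (hF.mono_ac h.quasiMeasurePreserving.absolutelyContinuous), h.map_eq, integral_smul_measure,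
    ENNReal.toReal_ofReal h.pos.le, smul_eq_mul]

theorem memLp_comp (h : MeasureScaling p c μ ν) (f : Lp ℝ 2 ν) : MemLp (f ∘ p) 2 μ :=
  (h.memLp_comp_iff (Lp.memLp f).1).2 (Lp.memLp f)

theorem inner_toLp (h : MeasureScaling p c μ ν) (f f' : Lp ℝ 2 ν) :
    inner ℝ (h.memLp_comp f).toLp (h.memLp_comp f').toLp = c * inner ℝ f f' := by
  rw [L2.inner_def, L2.inner_def, ← h.integral_comp (F := fun y => inner ℝ (f y) (f' y))
    ((Lp.memLp f).1.inner (Lp.memLp f').1)]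
  refine integral_congr_ae ?_
  filter_upwards [(h.memLp_comp f).coeFn_toLp, (h.memLp_comp f').coeFn_toLp] with x hx hx'
  rw [hx, hx']
  rfl

/-- Composition with `p`, as a map of `L²` spaces. -/
def pullback (h : MeasureScaling p c μ ν) : Lp ℝ 2 ν →L[ℝ] Lp ℝ 2 μ :=
  LinearMap.mkContinuous
    { toFun := fun f => (h.memLp_comp f).toLp
      map_add' := fun f f' => by
        rw [← MemLp.toLp_add]
        refine MemLp.toLp_congr _ _ ?_
        filter_upwards [h.quasiMeasurePreserving.ae (Lp.coeFn_add f f')] with x hx using hx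
      map_smul' := fun r f => by
        rw [RingHom.id_apply, ← MemLp.toLp_const_smul]
        refine MemLp.toLp_congr _ _ ?_
        filter_upwards [h.quasiMeasurePreserving.ae (Lp.coeFn_smul r f)] with x hx using hx }
    √c fun f => by
      have h1 := h.inner_toLp f f
      rw [real_inner_self_eq_norm_sq, real_inner_self_eq_norm_sq] at h1
      refine le_of_sq_le_sq ?_ (by positivity)
      rw [mul_pow, Real.sq_sqrt h.pos.le]
      exact h1.le

theorem pullback_apply (h : MeasureScaling p c μ ν) (f : Lp ℝ 2 ν) :
    h.pullback f = (h.memLp_comp f).toLp := rfl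

theorem coeFn_pullback (h : MeasureScaling p c μ ν) (f : Lp ℝ 2 ν) :
    h.pullback f =ᵐ[μ] f ∘ p := (h.memLp_comp f).coeFn_toLp

theorem inner_pullback (h : MeasureScaling p c μ ν) (f f' : Lp ℝ 2 ν) :
    inner ℝ (h.pullback f) (h.pullback f') = c * inner ℝ f f' := h.inner_toLp f f'

theorem pullback_toLp (h : MeasureScaling p c μ ν) {F : B → ℝ} (hF : MemLp F 2 ν)
    {F' : A → ℝ} (hF' : MemLp F' 2 μ) (heq : F ∘ p =ᵐ[μ] F') :
    h.pullback hF.toLp = hF'.toLp := by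
  refine MemLp.toLp_congr (h.memLp_comp _) hF' (EventuallyEq.trans ?_ heq)
  exact h.quasiMeasurePreserving.ae_eq_comp hF.coeFn_toLp

theorem comp (h : MeasureScaling p c μ ν) {p' : B → D} {c' : ℝ} {κ : Measure D}
    (h' : MeasureScaling p' c' ν κ) : MeasureScaling (fun x => p' (p x)) (c * c') μ κ := by
  refine ⟨h'.measurable.comp h.measurable, mul_pos h.pos h'.pos, ?_⟩
  rw [ENNReal.ofReal_mul h.pos.le, ← smul_smul, ← h'.map_eq, ← Measure.map_smul, ← h.map_eq,
    Measure.map_map h'.measurable h.measurable]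
  rfl

theorem pullback_pullback (h : MeasureScaling p c μ ν) {p' : B → D} {c' : ℝ} {κ : Measure D}
    (h' : MeasureScaling p' c' ν κ) {p'' : A → D} {c'' : ℝ} (h'' : MeasureScaling p'' c'' μ κ)
    (hp : ∀ x, p' (p x) = p'' x) (f : Lp ℝ 2 κ) :
    h.pullback (h'.pullback f) = h''.pullback f := by
  refine h.pullback_toLp (h'.memLp_comp f) (h''.memLp_comp f) (Eventually.of_forall fun x => ?_)
  simp only [Function.comp_apply, hp]

theorem pullback_eq_self {p : A → A} (h : MeasureScaling p c μ μ) (hp : ∀ x, p x = x)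
    (f : Lp ℝ 2 μ) : h.pullback f = f := by
  refine Lp.ext ((h.coeFn_pullback f).trans (Eventually.of_forall fun x => ?_))
  simp only [Function.comp_apply, hp]

theorem pullback_injective (h : MeasureScaling p c μ ν) : Function.Injective h.pullback := by
  refine (injective_iff_map_eq_zero _).2 fun f hf => ?_
  have h1 := h.inner_pullback f f
  rw [hf, inner_zero_left, eq_comm, mul_eq_zero, inner_self_eq_zero] at h1
  exact h1.resolve_left h.pos.ne'

/-- The adjoint of the composition with `p`, normalized to be a left inverse of it. -/
def pushforward (h : MeasureScaling p c μ ν) : Lp ℝ 2 μ →L[ℝ] Lp ℝ 2 ν :=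
  c⁻¹ • ContinuousLinearMap.adjoint h.pullback

theorem inner_pullback_left (h : MeasureScaling p c μ ν) (f : Lp ℝ 2 ν) (f' : Lp ℝ 2 μ) :
    inner ℝ (h.pullback f) f' = c * inner ℝ f (h.pushforward f') := by
  rw [pushforward, _root_.smul_apply, real_inner_smul_right,
    ContinuousLinearMap.adjoint_inner_right, mul_inv_cancel_left₀ h.pos.ne']

theorem pushforward_pullback (h : MeasureScaling p c μ ν) (f : Lp ℝ 2 ν) :
    h.pushforward (h.pullback f) = f := by
  refine ext_inner_left ℝ fun f' => mul_left_cancel₀ h.pos.ne' ?_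
  rw [← h.inner_pullback_left, h.inner_pullback]

theorem inner_pushforward_left (h : MeasureScaling p c μ ν) (f' : Lp ℝ 2 μ) (f : Lp ℝ 2 ν) :
    inner ℝ (h.pushforward f') f = c⁻¹ * inner ℝ f' (h.pullback f) := by
  rw [real_inner_comm, real_inner_comm (h.pullback f), h.inner_pullback_left,
    inv_mul_cancel_left₀ h.pos.ne']

end MeasureScaling

end Pullback

/-! ### Functions and measures on the quotient by a free action of a finite group -/

section InducedFunction

variable {G M : Type*} [Group G] [MulAction G M]

theorem quotProj_smul (a : G) (x : M) : quotProj G M (a • x) = quotProj G M x :=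
  Quotient.sound ⟨a, rfl⟩

variable [Fintype G] [IsCancelSMul G M]

theorem inducedFunction_quotProj_eq_sum (f : M → ℝ) (x : M) :
    inducedFunction G f (quotProj G M x) = (Fintype.card G : ℝ)⁻¹ * ∑ a : G, f (a • x) := by
  let e : G ≃ {y : M // quotProj G M y = quotProj G M x} :=
    Equiv.ofBijective (fun a => ⟨a • x, quotProj_smul a x⟩)
      ⟨fun a b hab => IsCancelSMul.right_cancel a b x (congrArg Subtype.val hab), fun ⟨y, hy⟩ => by
        obtain ⟨a, ha⟩ := Quotient.exact hy
        exact ⟨a, Subtype.ext ha⟩⟩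
  unfold inducedFunction
  rw [← finsum_comp_equiv e, finsum_eq_sum_of_fintype, ← Nat.card_congr e,
    Nat.card_eq_fintype_card, div_eq_inv_mul]
  rfl

theorem inducedFunction_mul_comp_quotProj (f : orbitRel.Quotient G M → ℝ) (f' : M → ℝ) :
    inducedFunction G (fun x => f (quotProj G M x) * f' x) =
      fun q => f q * inducedFunction G f' q := by
  ext q
  obtain ⟨x, rfl⟩ := Quotient.mk_surjective (s := orbitRel G M) q
  change inducedFunction G _ (quotProj G M x) = f (quotProj G M x) *
    inducedFunction G f' (quotProj G M x)
  rw [inducedFunction_quotProj_eq_sum, inducedFunction_quotProj_eq_sum, mul_left_comm,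
    Finset.mul_sum (a := f (quotProj G M x))]
  congr 1
  refine Finset.sum_congr rfl fun a _ => ?_
  rw [quotProj_smul]

theorem inducedFunction_comp_quotProj (f : orbitRel.Quotient G M → ℝ) :
    inducedFunction G (fun x => f (quotProj G M x)) = f := by
  ext q
  obtain ⟨x, rfl⟩ := Quotient.mk_surjective (s := orbitRel G M) q
  change inducedFunction G _ (quotProj G M x) = f (quotProj G M x)
  rw [inducedFunction_quotProj_eq_sum]
  simp only [quotProj_smul, Finset.sum_const, Finset.card_univ, nsmul_eq_mul]
  rw [inv_mul_cancel_left₀ (by exact_mod_cast Fintype.card_ne_zero)]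

end InducedFunction

section Quotient

variable {G M : Type*} [Group G] [Fintype G] [MulAction G M] [IsCancelSMul G M]
  [TopologicalSpace M] [T2Space M] [LocallyCompactSpace M] [ContinuousConstSMul G M]

theorem continuous_quotProj : Continuous (quotProj G M) :=
  quotProj_isLocalHomeomorph.continuous

theorem quotSection_symm_apply (x z : M) : (quotSection G x).symm z = quotProj G M z := by
  rw [quotSection, quotProj_isLocalHomeomorph.localInverseAt_symm]

theorem exists_finset_iUnion_source_eq_univ [CompactSpace M] :
    ∃ t : Finset M, ⋃ x ∈ t, (quotSection G x).source = univ := by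
  obtain ⟨t, ht⟩ := isCompact_univ.elim_finite_subcover (fun x : M => (quotSection G x).source)
    (fun x => (quotSection G x).open_source) fun q _ => mem_iUnion.2 ⟨q.out, mem_quotSection_out q⟩
  exact ⟨t, univ_subset_iff.1 ht⟩

variable [MeasurableSpace M] [BorelSpace M] [MeasurableSpace (orbitRel.Quotient G M)]
  [BorelSpace (orbitRel.Quotient G M)] [CompactSpace M]

theorem measurable_of_measurable_comp_quotProj {F : orbitRel.Quotient G M → ℝ}
    (hF : Measurable fun x => F (quotProj G M x)) : Measurable F := by
  intro s hs
  obtain ⟨t, ht⟩ := exists_finset_iUnion_source_eq_univ (G := G) (M := M)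
  have h : F ⁻¹' s = ⋃ x ∈ t, (quotSection G x).source ∩
      quotSection G x ⁻¹' ((fun x => F (quotProj G M x)) ⁻¹' s) := by
    ext q
    simp only [mem_preimage, mem_iUnion, mem_inter_iff]
    constructor
    · intro hq
      obtain ⟨x, hx, hqx⟩ := mem_iUnion₂.1 (ht.symm.subset (mem_univ q))
      exact ⟨x, hx, hqx, by rwa [quotProj_quotSection hqx]⟩
    · rintro ⟨x, hx, hqx, hq⟩
      rwa [quotProj_quotSection hqx] at hq
  rw [h]
  exact Finset.measurableSet_biUnion _ fun x _ =>
    measurableSet_source_inter_preimage (quotSection G x) (hF hs)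

theorem measurable_inducedFunction {f : M → ℝ} (hf : Measurable f) :
    Measurable (inducedFunction G f) := by
  refine measurable_of_measurable_comp_quotProj ?_
  simp only [inducedFunction_quotProj_eq_sum]
  exact (Finset.measurable_sum _ fun a _ =>
    hf.comp (continuous_const_smul a).measurable).const_mul _

/-- A measure on the quotient that corresponds to an invariant measure under the local sections of
the projection is its image, up to the order of the group: the preimage of a small set consists of
disjoint translates of its image under a section. -/
theorem measureScaling_quotProj {μ : Measure M} {ν : Measure (orbitRel.Quotient G M)}
    (hinv : ∀ (a : G) (s : Set M), MeasurableSet s → μ ((a • ·) ⁻¹' s) = μ s)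
    (hloc : ∀ (x : M) (s : Set (orbitRel.Quotient G M)), MeasurableSet s →
      μ ((quotSection G x).target ∩ quotProj G M ⁻¹' s) = ν ((quotSection G x).source ∩ s)) :
    MeasureScaling (quotProj G M) (Fintype.card G) μ ν := by
  refine ⟨continuous_quotProj.measurable, by exact_mod_cast Fintype.card_pos, ?_⟩
  obtain ⟨t, ht⟩ := exists_finset_iUnion_source_eq_univ (G := G) (M := M)
  have h : ∀ x ∈ t, (μ.map (quotProj G M)).restrict (quotSection G x).source =
      (ENNReal.ofReal (Fintype.card G) • ν).restrict (quotSection G x).source := by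
    intro x _
    ext s hs
    have ho : MeasurableSet (quotSection G x).source := (quotSection G x).open_source.measurableSet
    set Z := (quotSection G x).target ∩ quotProj G M ⁻¹' s
    have hZ : MeasurableSet Z := (quotSection G x).open_target.measurableSet.inter
      (continuous_quotProj.measurable hs)
    have hpre : quotProj G M ⁻¹' (s ∩ (quotSection G x).source) =
        ⋃ a : G, (a • ·) ⁻¹' Z := by
      ext y
      simp only [mem_preimage, mem_iUnion, mem_inter_iff, Z]
      simp only [quotProj_smul]
      constructor
      · rintro ⟨h1, h2⟩
        obtain ⟨a, ha⟩ := quotProj_eq_iff.1 (quotProj_quotSection h2)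
        exact ⟨a, by rw [ha]; exact (quotSection G x).map_source h2, h1⟩
      · rintro ⟨a, h1, h2⟩
        refine ⟨h2, ?_⟩
        have := (quotSection G x).map_target h1
        rwa [quotSection_symm_apply, quotProj_smul] at this
    have hdisj : Pairwise (Function.onFun Disjoint fun a : G => (a • · : M → M) ⁻¹' Z) := by
      intro a b hab
      refine disjoint_left.2 fun y ha hb => hab ?_
      have h1 := quotSection_quotProj ha.1
      have h2 := quotSection_quotProj hb.1
      rw [quotProj_smul] at h1 h2
      exact IsCancelSMul.right_cancel a b y (h1.symm.trans h2)
    rw [Measure.restrict_apply hs, Measure.restrict_apply hs,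
      Measure.map_apply continuous_quotProj.measurable (hs.inter ho), hpre,
      measure_iUnion hdisj fun a => (continuous_const_smul a).measurable hZ, tsum_fintype,
      Finset.sum_congr rfl fun a _ => hinv a Z hZ, hloc x s hs, Finset.sum_const,
      Measure.smul_apply, inter_comm, Finset.card_univ, nsmul_eq_mul, smul_eq_mul,
      ENNReal.ofReal_natCast]
  have h2 := (Measure.restrict_biUnion_congr t.countable_toSet).2 h
  simpa only [Finset.mem_coe, ht, Measure.restrict_univ] using h2

variable {μ : Measure M} {ν : Measure (orbitRel.Quotient G M)}

/-- A property that holds almost everywhere on `M` holds on almost all orbits. -/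
theorem MeasureScaling.ae_quotient (h : MeasureScaling (quotProj G M) (Fintype.card G) μ ν)
    (hinv : ∀ a : G, Measure.QuasiMeasurePreserving (a • · : M → M) μ μ) {P : M → Prop}
    (hP : ∀ᵐ x ∂μ, P x) : ∀ᵐ q ∂ν, ∀ x, quotProj G M x = q → P x := by
  have h0 : μ (toMeasurable μ {x | ¬ P x}) = 0 := by
    rw [measure_toMeasurable]
    exact hP
  set Z := toMeasurable μ {x | ¬ P x}
  have hZ : MeasurableSet Z := measurableSet_toMeasurable _ _
  -- the average over orbits of the indicator function of a measurable null set
  set F := inducedFunction G (Z.indicator fun _ => (1 : ℝ))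
  have hF : Measurable F := measurable_inducedFunction (measurable_const.indicator hZ)
  have hae : ∀ᵐ x ∂μ, F (quotProj G M x) = 0 := by
    have h1 : ∀ᵐ x ∂μ, ∀ a : G, a • x ∉ Z :=
      ae_all_iff.2 fun a => (hinv a).ae (measure_eq_zero_iff_ae_notMem.1 h0)
    filter_upwards [h1] with x hx
    simp only [F, inducedFunction_quotProj_eq_sum]
    rw [Finset.sum_eq_zero fun a _ => indicator_of_notMem (hx a) _, mul_zero]
  have hae2 : ∀ᵐ q ∂ν, F q = 0 := by
    refine h.absolutelyContinuous.ae_le ?_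
    exact (ae_map_iff h.measurable.aemeasurable
      (measurableSet_eq_fun hF measurable_const)).2 hae
  filter_upwards [hae2] with q hq x hx
  by_contra hPx
  rw [← hx] at hq
  simp only [F, inducedFunction_quotProj_eq_sum] at hq
  have h2 : ∑ a : G, Z.indicator (fun _ => (1 : ℝ)) (a • x) = 0 := by
    rcases mul_eq_zero.1 hq with h3 | h3
    · exact absurd h3 (inv_ne_zero (by exact_mod_cast Fintype.card_ne_zero))
    · exact h3
  have h3 := (Finset.sum_eq_zero_iff_of_nonneg fun a _ =>
    indicator_nonneg (fun _ _ => zero_le_one) _).1 h2 1 (Finset.mem_univ _)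
  rw [one_smul, indicator_of_mem (subset_toMeasurable _ _ hPx)] at h3
  exact one_ne_zero h3

end Quotient

section QuotientLp

variable {G M : Type*} [Group G] [Fintype G] [MulAction G M] [IsCancelSMul G M]
  [TopologicalSpace M] [T2Space M] [LocallyCompactSpace M] [ContinuousConstSMul G M]
  [MeasurableSpace M] [BorelSpace M] [MeasurableSpace (orbitRel.Quotient G M)]
  [BorelSpace (orbitRel.Quotient G M)] [CompactSpace M]
  {μ : Measure M} {ν : Measure (orbitRel.Quotient G M)}

namespace MeasureScaling

theorem ae_eq_of_comp_quotProj (h : MeasureScaling (quotProj G M) (Fintype.card G) μ ν)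
    (hU : ∀ a : G, MeasureScaling (a • · : M → M) 1 μ μ) {F F' : orbitRel.Quotient G M → ℝ}
    (hF : ∀ᵐ x ∂μ, F (quotProj G M x) = F' (quotProj G M x)) : F =ᵐ[ν] F' := by
  filter_upwards [h.ae_quotient (fun a => (hU a).quasiMeasurePreserving) hF] with q hq
  have := hq q.out (quotProj_out q)
  rwa [quotProj_out] at this

theorem inducedFunction_congr_ae (h : MeasureScaling (quotProj G M) (Fintype.card G) μ ν)
    (hU : ∀ a : G, MeasureScaling (a • · : M → M) 1 μ μ) {f f' : M → ℝ} (hf : f =ᵐ[μ] f') :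
    inducedFunction G f =ᵐ[ν] inducedFunction G f' := by
  refine h.ae_eq_of_comp_quotProj hU ?_
  filter_upwards [ae_all_iff.2 fun a => (hU a).quasiMeasurePreserving.ae hf] with x hx
  simp only [inducedFunction_quotProj_eq_sum, hx]

theorem inducedFunction_quotProj_ae_eq
    {f : M → ℝ} (hf : ∀ a : G, ∀ᵐ x ∂μ, f (a • x) = f x) :
    ∀ᵐ x ∂μ, inducedFunction G f (quotProj G M x) = f x := by
  filter_upwards [ae_all_iff.2 hf] with x hx
  rw [inducedFunction_quotProj_eq_sum]
  simp only [hx, Finset.sum_const, Finset.card_univ, nsmul_eq_mul]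
  rw [inv_mul_cancel_left₀ (by exact_mod_cast Fintype.card_ne_zero)]

theorem aestronglyMeasurable_inducedFunction
    (h : MeasureScaling (quotProj G M) (Fintype.card G) μ ν)
    (hU : ∀ a : G, MeasureScaling (a • · : M → M) 1 μ μ) {f : M → ℝ}
    (hf : AEStronglyMeasurable f μ) : AEStronglyMeasurable (inducedFunction G f) ν :=
  ⟨inducedFunction G (hf.mk f),
    (measurable_inducedFunction hf.stronglyMeasurable_mk.measurable).stronglyMeasurable,
    h.inducedFunction_congr_ae hU hf.ae_eq_mk⟩

theorem memLp_inducedFunction (h : MeasureScaling (quotProj G M) (Fintype.card G) μ ν)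
    (hU : ∀ a : G, MeasureScaling (a • · : M → M) 1 μ μ) {f : M → ℝ} {q : ENNReal}
    (hf : MemLp f q μ) : MemLp (inducedFunction G f) q ν := by
  rw [← h.memLp_comp_iff (h.aestronglyMeasurable_inducedFunction hU hf.1)]
  have h1 : inducedFunction G f ∘ quotProj G M =
      (Fintype.card G : ℝ)⁻¹ • ∑ a : G, f ∘ (a • · : M → M) := by
    ext x
    simp [inducedFunction_quotProj_eq_sum]
  rw [h1]
  exact (memLp_finsetSum' _ fun a _ => ((hU a).memLp_comp_iff hf.1).2 hf).const_smul _

theorem integral_inducedFunction (h : MeasureScaling (quotProj G M) (Fintype.card G) μ ν)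
    (hU : ∀ a : G, MeasureScaling (a • · : M → M) 1 μ μ) {f : M → ℝ} (hf : Integrable f μ) :
    ∫ q, inducedFunction G f q ∂ν = (Fintype.card G : ℝ)⁻¹ * ∫ x, f x ∂μ := by
  have hc : (Fintype.card G : ℝ) ≠ 0 := by exact_mod_cast Fintype.card_ne_zero
  have hfa : ∀ a : G, Integrable (fun x => f (a • x)) μ := fun a => by
    rw [← memLp_one_iff_integrable] at hf ⊢
    exact ((hU a).memLp_comp_iff hf.1).2 hf
  have h1 : ∀ a : G, ∫ x, f (a • x) ∂μ = ∫ x, f x ∂μ := fun a => by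
    rw [(hU a).integral_comp hf.1, one_mul]
  have h2 := h.integral_comp (h.aestronglyMeasurable_inducedFunction hU hf.1)
  simp only [inducedFunction_quotProj_eq_sum] at h2
  rw [integral_const_mul, integral_finsetSum _ fun a _ => hfa a] at h2
  simp only [h1, Finset.sum_const, Finset.card_univ, nsmul_eq_mul] at h2
  rw [inv_mul_cancel_left₀ hc] at h2
  rw [h2, inv_mul_cancel_left₀ hc]

/-- The normalized adjoint of the composition with the projection is the average over orbits. -/
theorem pushforward_toLp (h : MeasureScaling (quotProj G M) (Fintype.card G) μ ν)
    (hU : ∀ a : G, MeasureScaling (a • · : M → M) 1 μ μ) {f : M → ℝ} (hf : MemLp f 2 μ) :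
    h.pushforward hf.toLp = (h.memLp_inducedFunction hU hf).toLp := by
  refine ext_inner_right ℝ fun f' => ?_
  have hint : Integrable (fun x => f' (quotProj G M x) * f x) μ :=
    (h.memLp_comp f').integrable_mul hf
  have h1 : inner ℝ hf.toLp (h.pullback f') = ∫ x, f' (quotProj G M x) * f x ∂μ := by
    rw [L2.inner_def]
    refine integral_congr_ae ?_
    filter_upwards [hf.coeFn_toLp, h.coeFn_pullback f'] with x hx hx'
    rw [hx, hx']
    rfl
  have h2 : inner ℝ (h.memLp_inducedFunction hU hf).toLp f' =
      ∫ q, inducedFunction G (fun x => f' (quotProj G M x) * f x) q ∂ν := by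
    rw [L2.inner_def]
    refine integral_congr_ae ?_
    filter_upwards [(h.memLp_inducedFunction hU hf).coeFn_toLp] with q hq
    rw [hq, inducedFunction_mul_comp_quotProj]
    rfl
  rw [h.inner_pushforward_left, h1, h2, h.integral_inducedFunction hU hint]

theorem pullback_smul_pullback_quotProj
    (h : MeasureScaling (quotProj G M) (Fintype.card G) μ ν)
    (hU : ∀ a : G, MeasureScaling (a • · : M → M) 1 μ μ) (a : G) (f : Lp ℝ 2 ν) :
    (hU a).pullback (h.pullback f) = h.pullback f := by
  rw [h.pullback_apply]
  refine (hU a).pullback_toLp (h.memLp_comp f) (h.memLp_comp f) (Eventually.of_forall fun x => ?_)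
  simp only [Function.comp_apply, quotProj_smul]

theorem pullback_pushforward_of_invariant
    (h : MeasureScaling (quotProj G M) (Fintype.card G) μ ν)
    (hU : ∀ a : G, MeasureScaling (a • · : M → M) 1 μ μ) {u : Lp ℝ 2 μ}
    (hu : ∀ a, (hU a).pullback u = u) : h.pullback (h.pushforward u) = u := by
  have hinv : ∀ a : G, ∀ᵐ x ∂μ, u (a • x) = u x := by
    intro a
    have h1 := (hU a).coeFn_pullback u
    rw [hu a] at h1
    exact h1.symm
  have h2 : u = (Lp.memLp u).toLp := (Lp.toLp_coeFn u (Lp.memLp u)).symm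
  conv_lhs => rw [h2]
  conv_rhs => rw [h2]
  rw [h.pushforward_toLp hU]
  exact h.pullback_toLp _ _ (inducedFunction_quotProj_ae_eq hinv)

end MeasureScaling

end QuotientLp

/-! ### The weak Steklov problem of a Riemannian manifold -/

section WeakSteklov

variable {d : ℕ} {N : Type*} [TopologicalSpace N] [ChartedSpace (EuclideanHalfSpace (d + 1)) N]
  [IsManifold (𝓡∂ (d + 1)) ∞ N] [CompactSpace N] (g : RiemannianMetricOn (𝓡∂ (d + 1)) N)

theorem memLp_of_continuous {A : Type*} [TopologicalSpace A] [CompactSpace A] [MeasurableSpace A]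
    [BorelSpace A] (μ : Measure A) [IsFiniteMeasure μ] {f : A → ℝ} (hf : Continuous f)
    (q : ENNReal) : MemLp f q μ :=
  hf.memLp_of_hasCompactSupport (HasCompactSupport.of_compactSpace f)

theorem memLp_riemannianVolume {f : N → ℝ} (hf : Continuous f) (q : ENNReal) :
    MemLp f q (riemannianVolume g) := by
  let _ : MeasurableSpace N := borel N
  have : BorelSpace N := ⟨rfl⟩
  exact memLp_of_continuous _ hf q

theorem memLp_boundaryMeasure {f : N → ℝ} (hf : Continuous f) (q : ENNReal) :
    MemLp f q (boundaryMeasure g) := by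
  let _ : MeasurableSpace N := borel N
  have : BorelSpace N := ⟨rfl⟩
  exact memLp_of_continuous _ hf q

theorem memLp_mul_boundaryMeasure {ρ f : N → ℝ} (hρ : MemLp ρ ⊤ (boundaryMeasure g))
    (hf : Continuous f) : MemLp (fun x => ρ x * f x) 2 (boundaryMeasure g) :=
  (memLp_boundaryMeasure g hf 2).mul' hρ

theorem integrable_energyDensity (φ ψ : C^∞⟮𝓡∂ (d + 1), N; 𝓘(ℝ, ℝ), ℝ⟯) :
    Integrable (energyDensity g φ ψ) (riemannianVolume g) :=
  memLp_one_iff_integrable.1 (memLp_riemannianVolume g (continuous_energyDensity g φ ψ) 1)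

theorem dirichletForm_eq (φ ψ : C^∞⟮𝓡∂ (d + 1), N; 𝓘(ℝ, ℝ), ℝ⟯) :
    dirichletForm g φ ψ = ∫ x, energyDensity g φ ψ x ∂riemannianVolume g := rfl

/-- The weak Steklov problem with density `ρ`, with the smooth functions as test functions. -/
def weakSteklov {ρ : N → ℝ} (hρ : MemLp ρ ⊤ (boundaryMeasure g)) :
    WeakProblem C^∞⟮𝓡∂ (d + 1), N; 𝓘(ℝ, ℝ), ℝ⟯ (Lp ℝ 2 (riemannianVolume g))
      (Lp ℝ 2 (boundaryMeasure g)) where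
  incl :=
    { toFun := fun φ => (memLp_riemannianVolume g φ.contMDiff.continuous 2).toLp
      map_add' := fun _ _ => rfl
      map_smul' := fun _ _ => rfl }
  trace :=
    { toFun := fun φ => (memLp_boundaryMeasure g φ.contMDiff.continuous 2).toLp
      map_add' := fun _ _ => rfl
      map_smul' := fun _ _ => rfl }
  weight :=
    { toFun := fun φ => (memLp_mul_boundaryMeasure g hρ φ.contMDiff.continuous).toLp
      map_add' := fun φ ψ => by
        rw [← MemLp.toLp_add]
        refine MemLp.toLp_congr _ _ (Eventually.of_forall fun x => ?_)
        exact mul_add _ _ _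
      map_smul' := fun c φ => by
        rw [RingHom.id_apply, ← MemLp.toLp_const_smul]
        refine MemLp.toLp_congr _ _ (Eventually.of_forall fun x => ?_)
        exact mul_left_comm _ _ _ }
  energy := LinearMap.mk₂ ℝ (dirichletForm g)
    (fun φ φ' ψ => by
      simp only [dirichletForm_eq, energyDensity_add_left]
      exact integral_add (integrable_energyDensity g _ _) (integrable_energyDensity g _ _))
    (fun c φ ψ => by
      simp only [dirichletForm_eq, energyDensity_smul_left, smul_eq_mul]
      exact integral_const_mul _ _)
    (fun φ ψ ψ' => by
      simp only [dirichletForm_eq, energyDensity_add_right]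
      exact integral_add (integrable_energyDensity g _ _) (integrable_energyDensity g _ _))
    (fun c φ ψ => by
      simp only [dirichletForm_eq, energyDensity_smul_right, smul_eq_mul]
      exact integral_const_mul _ _)
  energy_nonneg := fun φ => integral_nonneg fun x => energyDensity_self_nonneg g φ x

variable {ρ : N → ℝ} (hρ : MemLp ρ ⊤ (boundaryMeasure g))

theorem weakSteklov_incl (φ : C^∞⟮𝓡∂ (d + 1), N; 𝓘(ℝ, ℝ), ℝ⟯) : (weakSteklov g hρ).incl φ =
    (memLp_riemannianVolume g φ.contMDiff.continuous 2).toLp := rfl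

theorem weakSteklov_trace (φ : C^∞⟮𝓡∂ (d + 1), N; 𝓘(ℝ, ℝ), ℝ⟯) : (weakSteklov g hρ).trace φ =
    (memLp_boundaryMeasure g φ.contMDiff.continuous 2).toLp := rfl

theorem weakSteklov_weight (φ : C^∞⟮𝓡∂ (d + 1), N; 𝓘(ℝ, ℝ), ℝ⟯) : (weakSteklov g hρ).weight φ =
    (memLp_mul_boundaryMeasure g hρ φ.contMDiff.continuous).toLp := rfl

theorem weakSteklov_energy (φ ψ : C^∞⟮𝓡∂ (d + 1), N; 𝓘(ℝ, ℝ), ℝ⟯) :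
    (weakSteklov g hρ).energy φ ψ = dirichletForm g φ ψ := rfl

theorem inner_weakSteklov_incl (u : Lp ℝ 2 (riemannianVolume g))
    (ψ : C^∞⟮𝓡∂ (d + 1), N; 𝓘(ℝ, ℝ), ℝ⟯) :
    inner ℝ u ((weakSteklov g hρ).incl ψ) = ∫ x, u x * ψ x ∂riemannianVolume g := by
  rw [L2.inner_def, weakSteklov_incl]
  refine integral_congr_ae ?_
  filter_upwards [(memLp_riemannianVolume g ψ.contMDiff.continuous 2).coeFn_toLp] with x hx
  rw [hx]
  exact mul_comm _ _

theorem inner_weakSteklov_weight (f : Lp ℝ 2 (boundaryMeasure g))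
    (ψ : C^∞⟮𝓡∂ (d + 1), N; 𝓘(ℝ, ℝ), ℝ⟯) :
    inner ℝ f ((weakSteklov g hρ).weight ψ) = ∫ x, ρ x * f x * ψ x ∂boundaryMeasure g := by
  rw [L2.inner_def, weakSteklov_weight]
  refine integral_congr_ae ?_
  filter_upwards [(memLp_mul_boundaryMeasure g hρ ψ.contMDiff.continuous).coeFn_toLp] with x hx
  rw [hx]
  exact mul_right_comm _ _ _

theorem tendsto_lintegral_energyDensity_iff {ι : Type*} {l : Filter ι}
    (χ : ι → C^∞⟮𝓡∂ (d + 1), N; 𝓘(ℝ, ℝ), ℝ⟯) :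
    Tendsto (fun i => ∫⁻ x, ENNReal.ofReal (energyDensity g (χ i) (χ i) x) ∂riemannianVolume g) l
      (𝓝 0) ↔ Tendsto (fun i => dirichletForm g (χ i) (χ i)) l (𝓝 0) := by
  have h1 : ∀ i, ∫⁻ x, ENNReal.ofReal (energyDensity g (χ i) (χ i) x) ∂riemannianVolume g =
      ENNReal.ofReal (dirichletForm g (χ i) (χ i)) := fun i =>
    (ofReal_integral_eq_lintegral_ofReal (integrable_energyDensity g _ _)
      (Eventually.of_forall fun x => energyDensity_self_nonneg g _ x)).symm
  have h2 : ∀ i, 0 ≤ dirichletForm g (χ i) (χ i) := fun i =>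
    integral_nonneg fun x => energyDensity_self_nonneg g _ x
  simp only [h1]
  constructor
  · intro h
    have h3 := (ENNReal.tendsto_toReal ENNReal.zero_ne_top).comp h
    simpa only [Function.comp_def, ENNReal.toReal_ofReal (h2 _), ENNReal.toReal_zero] using h3
  · intro h
    simpa only [ENNReal.ofReal_zero] using ENNReal.tendsto_ofReal h

theorem isSteklovSolution_iff {α σ : ℝ} {u : Lp ℝ 2 (riemannianVolume g)} :
    IsSteklovSolution g α ρ σ u ↔ u ∈ (weakSteklov g hρ).solutions α σ := by
  rw [WeakProblem.mem_solutions]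
  unfold IsSteklovSolution WeakProblem.IsSolution TendstoH1
  have h1 : ∀ φ : ℕ → C^∞⟮𝓡∂ (d + 1), N; 𝓘(ℝ, ℝ), ℝ⟯,
      Tendsto (fun k => eLpNorm (fun x => φ k x - u x) 2 (riemannianVolume g)) atTop (𝓝 0) ↔
        Tendsto (fun k => (weakSteklov g hρ).incl (φ k)) atTop (𝓝 u) := by
    intro φ
    rw [Lp.tendsto_Lp_iff_tendsto_eLpNorm']
    refine tendsto_congr fun k => eLpNorm_congr_ae ?_
    filter_upwards [(memLp_riemannianVolume g (φ k).contMDiff.continuous 2).coeFn_toLp] with x hx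
    rw [weakSteklov_incl, Pi.sub_apply, hx]
  have h2 : ∀ (φ : ℕ → C^∞⟮𝓡∂ (d + 1), N; 𝓘(ℝ, ℝ), ℝ⟯) (f : Lp ℝ 2 (boundaryMeasure g)),
      Tendsto (fun k => eLpNorm (fun x => φ k x - f x) 2 (boundaryMeasure g)) atTop (𝓝 0) ↔
        Tendsto (fun k => (weakSteklov g hρ).trace (φ k)) atTop (𝓝 f) := by
    intro φ f
    rw [Lp.tendsto_Lp_iff_tendsto_eLpNorm']
    refine tendsto_congr fun k => eLpNorm_congr_ae ?_
    filter_upwards [(memLp_boundaryMeasure g (φ k).contMDiff.continuous 2).coeFn_toLp] with x hx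
    rw [weakSteklov_trace, Pi.sub_apply, hx]
  have h3 : ∀ φ : ℕ → C^∞⟮𝓡∂ (d + 1), N; 𝓘(ℝ, ℝ), ℝ⟯,
      Tendsto (fun p : ℕ × ℕ => ∫⁻ x, ENNReal.ofReal
        (g.inner x (riemannianGradient g (φ p.1) x - riemannianGradient g (φ p.2) x)
          (riemannianGradient g (φ p.1) x - riemannianGradient g (φ p.2) x)) ∂riemannianVolume g)
        atTop (𝓝 0) ↔
      Tendsto (fun p : ℕ × ℕ => (weakSteklov g hρ).energy (φ p.1 - φ p.2) (φ p.1 - φ p.2)) atTop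
        (𝓝 0) := by
    intro φ
    simp only [weakSteklov_energy, ← tendsto_lintegral_energyDensity_iff, energyDensity,
      riemannianGradient_sub]
  simp only [h1, h2, h3, weakSteklov_energy, inner_weakSteklov_incl, inner_weakSteklov_weight,
    and_assoc]

theorem steklovMultiplicity_eq_rank (α σ : ℝ) :
    steklovMultiplicity g α ρ σ = Module.rank ℝ ((weakSteklov g hρ).solutions α σ) := by
  unfold steklovMultiplicity
  have h : {u | IsSteklovSolution g α ρ σ u} = ((weakSteklov g hρ).solutions α σ : Set _) :=
    Set.ext fun u => isSteklovSolution_iff g hρ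
  rw [h, Submodule.span_eq]

theorem mem_steklovSpectrum_iff (α σ : ℝ) :
    σ ∈ steklovSpectrum g α ρ ↔ Module.rank ℝ ((weakSteklov g hρ).solutions α σ) ≠ 0 := by
  rw [Ne, Submodule.rank_eq_zero, Submodule.eq_bot_iff]
  push Not
  constructor
  · rintro ⟨u, hu, h⟩
    exact ⟨u, (isSteklovSolution_iff g hρ).1 h, hu⟩
  · rintro ⟨u, h, hu⟩
    exact ⟨u, hu, (isSteklovSolution_iff g hρ).2 h⟩

end WeakSteklov

/-! ### Isometries and coverings -/

section SmoothMaps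

variable {d : ℕ} {M N : Type*} [TopologicalSpace M] [ChartedSpace (EuclideanHalfSpace (d + 1)) M]
  [IsManifold (𝓡∂ (d + 1)) ∞ M] [TopologicalSpace N]
  [ChartedSpace (EuclideanHalfSpace (d + 1)) N] [IsManifold (𝓡∂ (d + 1)) ∞ N]
  {gM : RiemannianMetricOn (𝓡∂ (d + 1)) M} {gN : RiemannianMetricOn (𝓡∂ (d + 1)) N}

/-- Composition of smooth functions with a smooth map. -/
def compSmooth {p : M → N} (hp : ContMDiff (𝓡∂ (d + 1)) (𝓡∂ (d + 1)) ∞ p) :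
    C^∞⟮𝓡∂ (d + 1), N; 𝓘(ℝ, ℝ), ℝ⟯ →ₗ[ℝ] C^∞⟮𝓡∂ (d + 1), M; 𝓘(ℝ, ℝ), ℝ⟯ where
  toFun φ := ⟨fun x => φ (p x), φ.contMDiff.comp hp⟩
  map_add' _ _ := rfl
  map_smul' _ _ := rfl

@[simp]
theorem compSmooth_apply {p : M → N} (hp : ContMDiff (𝓡∂ (d + 1)) (𝓡∂ (d + 1)) ∞ p)
    (φ : C^∞⟮𝓡∂ (d + 1), N; 𝓘(ℝ, ℝ), ℝ⟯) (x : M) : compSmooth hp φ x = φ (p x) := rfl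

/-- The differential of a local isometry maps the gradient of `φ ∘ p` to that of `φ`. -/
theorem energyDensity_compSmooth {p : M → N} (hp : ContMDiff (𝓡∂ (d + 1)) (𝓡∂ (d + 1)) ∞ p)
    (hinner : ∀ x (v w : TangentSpace (𝓡∂ (d + 1)) x),
      gN.inner (p x) (mfderiv (𝓡∂ (d + 1)) (𝓡∂ (d + 1)) p x v)
        (mfderiv (𝓡∂ (d + 1)) (𝓡∂ (d + 1)) p x w) = gM.inner x v w)
    (φ ψ : C^∞⟮𝓡∂ (d + 1), N; 𝓘(ℝ, ℝ), ℝ⟯) (x : M) :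
    energyDensity gM (compSmooth hp φ) (compSmooth hp ψ) x = energyDensity gN φ ψ (p x) := by
  set D := mfderiv (𝓡∂ (d + 1)) (𝓡∂ (d + 1)) p x
  have hinj : Function.Injective D := by
    refine (injective_iff_map_eq_zero D).2 fun v hv => ?_
    by_contra hne
    have h1 := gM.pos x v hne
    rw [← hinner x v v] at h1
    change 0 < gN.inner (p x) (D v) (D v) at h1
    rw [hv] at h1
    simp at h1
  have hsurj : Function.Surjective D := by
    let A : EuclideanSpace ℝ (Fin (d + 1)) →L[ℝ] EuclideanSpace ℝ (Fin (d + 1)) := D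
    exact (LinearMap.injective_iff_surjective (f := A.toLinearMap)).1 hinj
  have hgrad : ∀ φ : C^∞⟮𝓡∂ (d + 1), N; 𝓘(ℝ, ℝ), ℝ⟯,
      D (riemannianGradient gM (compSmooth hp φ) x) = riemannianGradient gN φ (p x) := by
    intro φ
    refine eq_of_inner_eq gN fun w => ?_
    obtain ⟨v, rfl⟩ := hsurj w
    refine (hinner x _ v).trans ?_
    rw [inner_riemannianGradient]
    refine Eq.trans ?_ (inner_riemannianGradient gN φ (p x) _).symm
    have h := mfderiv_comp x (mdifferentiableAt_smoothMap φ (p x))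
      (hp.mdifferentiable (by simp) x)
    exact congrArg (fun L : TangentSpace (𝓡∂ (d + 1)) x →L[ℝ] ℝ => L v) h
  unfold energyDensity
  rw [← hinner, hgrad, hgrad]

variable [CompactSpace M] [CompactSpace N] {p : M → N}
  (hp : ContMDiff (𝓡∂ (d + 1)) (𝓡∂ (d + 1)) ∞ p) {c : ℝ} {ρM : M → ℝ} {ρN : N → ℝ}
  (hρM : MemLp ρM ⊤ (boundaryMeasure gM)) (hρN : MemLp ρN ⊤ (boundaryMeasure gN))
  (φ : C^∞⟮𝓡∂ (d + 1), N; 𝓘(ℝ, ℝ), ℝ⟯)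

theorem pullback_incl (h : MeasureScaling p c (riemannianVolume gM) (riemannianVolume gN)) :
    h.pullback ((weakSteklov gN hρN).incl φ) = (weakSteklov gM hρM).incl (compSmooth hp φ) :=
  h.pullback_toLp (memLp_riemannianVolume gN φ.contMDiff.continuous 2)
    (memLp_riemannianVolume gM (compSmooth hp φ).contMDiff.continuous 2) EventuallyEq.rfl

theorem pullback_trace (h : MeasureScaling p c (boundaryMeasure gM) (boundaryMeasure gN)) :
    h.pullback ((weakSteklov gN hρN).trace φ) = (weakSteklov gM hρM).trace (compSmooth hp φ) :=
  h.pullback_toLp (memLp_boundaryMeasure gN φ.contMDiff.continuous 2)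
    (memLp_boundaryMeasure gM (compSmooth hp φ).contMDiff.continuous 2) EventuallyEq.rfl

theorem pullback_weight (h : MeasureScaling p c (boundaryMeasure gM) (boundaryMeasure gN))
    (hρ : ∀ᵐ x ∂boundaryMeasure gM, ρN (p x) = ρM x) :
    h.pullback ((weakSteklov gN hρN).weight φ) = (weakSteklov gM hρM).weight (compSmooth hp φ) := by
  refine h.pullback_toLp (memLp_mul_boundaryMeasure gN hρN φ.contMDiff.continuous)
    (memLp_mul_boundaryMeasure gM hρM (compSmooth hp φ).contMDiff.continuous) ?_
  filter_upwards [hρ] with x hx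
  simp only [Function.comp_apply, compSmooth_apply, hx]

end SmoothMaps

section Isometry

variable {d : ℕ} {M : Type*} [TopologicalSpace M] [ChartedSpace (EuclideanHalfSpace (d + 1)) M]
  [IsManifold (𝓡∂ (d + 1)) ∞ M] {g : RiemannianMetricOn (𝓡∂ (d + 1)) M}
  {F : M ≃ₘ^∞⟮𝓡∂ (d + 1), 𝓡∂ (d + 1)⟯ M}

theorem PreservesMetric.isPartialIsometry (hF : PreservesMetric g F) :
    IsPartialIsometry g g F.toHomeomorph.toOpenPartialHomeomorph :=
  ⟨F.contMDiff_toFun.contMDiffOn, F.contMDiff_invFun.contMDiffOn, fun x _ => hF x⟩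

theorem PreservesMetric.symm (hF : PreservesMetric g F) : PreservesMetric g F.symm :=
  fun x => hF.isPartialIsometry.symm.inner_eq x (mem_univ x)

theorem PreservesMetric.measureScaling_volume (hF : PreservesMetric g F) :
    MeasureScaling F 1 (riemannianVolume g) (riemannianVolume g) := by
  let _ : MeasurableSpace M := borel M
  have : BorelSpace M := ⟨rfl⟩
  refine ⟨F.continuous.measurable, one_pos, ?_⟩
  ext s hs
  rw [Measure.map_apply F.continuous.measurable hs, ENNReal.ofReal_one, one_smul]
  have h := hF.isPartialIsometry.riemannianVolume_preimage hs
  rwa [Homeomorph.toOpenPartialHomeomorph_source, Homeomorph.toOpenPartialHomeomorph_target,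
    univ_inter, univ_inter] at h

theorem PreservesMetric.measureScaling_boundary (hF : PreservesMetric g F) :
    MeasureScaling F 1 (boundaryMeasure g) (boundaryMeasure g) := by
  let _ : MeasurableSpace M := borel M
  have : BorelSpace M := ⟨rfl⟩
  refine ⟨F.continuous.measurable, one_pos, ?_⟩
  ext s hs
  rw [Measure.map_apply F.continuous.measurable hs, ENNReal.ofReal_one, one_smul]
  have h := hF.isPartialIsometry.boundaryMeasure_preimage hs
  rwa [Homeomorph.toOpenPartialHomeomorph_source, Homeomorph.toOpenPartialHomeomorph_target,
    univ_inter, univ_inter] at h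

variable [CompactSpace M]

theorem dirichletForm_comm (φ ψ : C^∞⟮𝓡∂ (d + 1), M; 𝓘(ℝ, ℝ), ℝ⟯) :
    dirichletForm g φ ψ = dirichletForm g ψ φ := by
  simp only [dirichletForm_eq, energyDensity_comm g φ ψ]

theorem PreservesMetric.dirichletForm_comp (hF : PreservesMetric g F)
    (φ ψ : C^∞⟮𝓡∂ (d + 1), M; 𝓘(ℝ, ℝ), ℝ⟯) :
    dirichletForm g (compSmooth F.contMDiff_toFun φ) (compSmooth F.contMDiff_toFun ψ) =
      dirichletForm g φ ψ := by
  have h := hF.measureScaling_volume.integral_comp (integrable_energyDensity g φ ψ).1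
  simp only [dirichletForm_eq, energyDensity_compSmooth F.contMDiff_toFun hF]
  exact h.trans (one_mul _)

/-- An isometry `F` maps the solutions with density `ρ` to solutions with density `ρ ∘ F`. -/
theorem PreservesMetric.pullback_mem_solutions (hF : PreservesMetric g F) {ρ ρ' : M → ℝ}
    {hρ : MemLp ρ ⊤ (boundaryMeasure g)} {hρ' : MemLp ρ' ⊤ (boundaryMeasure g)}
    (hρρ' : ∀ᵐ x ∂boundaryMeasure g, ρ (F x) = ρ' x) {α σ : ℝ}
    {u : Lp ℝ 2 (riemannianVolume g)} (hu : u ∈ (weakSteklov g hρ).solutions α σ) :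
    hF.measureScaling_volume.pullback u ∈ (weakSteklov g hρ').solutions α σ := by
  have hPQ : ∀ ψ : C^∞⟮𝓡∂ (d + 1), M; 𝓘(ℝ, ℝ), ℝ⟯,
      compSmooth F.contMDiff_toFun (compSmooth F.symm.contMDiff_toFun ψ) = ψ := fun ψ =>
    ContMDiffMap.ext fun x => congrArg ψ (F.symm_apply_apply x)
  refine (WeakProblem.solutions_of_adjoint (S := weakSteklov g hρ) (S' := weakSteklov g hρ')
    (PC := compSmooth F.contMDiff_toFun) (QC := compSmooth F.symm.contMDiff_toFun)
    (PX := hF.measureScaling_volume.pullback) (PY := hF.measureScaling_boundary.pullback)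
    (QX := hF.measureScaling_volume.pushforward) (QY := hF.measureScaling_boundary.pushforward) one_pos
    (fun φ => ContMDiffMap.ext fun x => congrArg φ (F.apply_symm_apply x))
    (fun φ => pullback_incl _ hρ' hρ φ _) (fun ψ => ?_)
    (fun φ => pullback_trace _ hρ' hρ φ _) (fun ψ => ?_)
    (fun φ => pullback_weight _ hρ' hρ φ _ hρρ') (fun ψ => ?_)
    hF.measureScaling_volume.inner_pullback_left hF.measureScaling_boundary.inner_pullback_left
    dirichletForm_comm dirichletForm_comm fun φ ψ => ?_).1 u hu
  · conv_lhs => rw [← hPQ ψ, ← pullback_incl F.contMDiff_toFun hρ' hρ _ hF.measureScaling_volume,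
      MeasureScaling.pushforward_pullback]
  · conv_lhs => rw [← hPQ ψ, ← pullback_trace F.contMDiff_toFun hρ' hρ _
      hF.measureScaling_boundary, MeasureScaling.pushforward_pullback]
  · conv_lhs => rw [← hPQ ψ, ← pullback_weight F.contMDiff_toFun hρ' hρ _
      hF.measureScaling_boundary hρρ', MeasureScaling.pushforward_pullback]
  · rw [one_mul, weakSteklov_energy, weakSteklov_energy]
    conv_lhs => rw [← hPQ ψ]
    exact hF.dirichletForm_comp _ _

end Isometry

/-! ### Solutions on the quotient and invariant solutions -/

section Covering

variable {d : ℕ} {M : Type*} [TopologicalSpace M] [CompactSpace M] [T2Space M]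
  [ChartedSpace (EuclideanHalfSpace (d + 1)) M] [IsManifold (𝓡∂ (d + 1)) ∞ M]
  {g : RiemannianMetricOn (𝓡∂ (d + 1)) M} {G : Type*} [Group G] [MulAction G M]
  [ContinuousConstSMul G M] [ContMDiffConstSMul (𝓡∂ (d + 1)) G M]

variable (d M) in
/-- The diffeomorphism given by an element of the group. -/
def smulDiffeomorph (a : G) : M ≃ₘ^∞⟮𝓡∂ (d + 1), 𝓡∂ (d + 1)⟯ M where
  toEquiv := MulAction.toPerm a
  contMDiff_toFun := ContMDiffConstSMul.contMDiff_const_smul a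
  contMDiff_invFun := ContMDiffConstSMul.contMDiff_const_smul a⁻¹

theorem measureScaling_smul_volume {a : G} (ha : PreservesMetric g (fun x : M => a • x)) :
    MeasureScaling (a • · : M → M) 1 (riemannianVolume g) (riemannianVolume g) :=
  PreservesMetric.measureScaling_volume (F := smulDiffeomorph d M a) ha

theorem measureScaling_smul_boundary {a : G} (ha : PreservesMetric g (fun x : M => a • x)) :
    MeasureScaling (a • · : M → M) 1 (boundaryMeasure g) (boundaryMeasure g) :=
  PreservesMetric.measureScaling_boundary (F := smulDiffeomorph d M a) ha

variable [Fintype G] [IsCancelSMul G M] (hg : ∀ a : G, PreservesMetric g (fun x : M => a • x))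

theorem isPartialIsometry_quotSection_symm (x : M) :
    IsPartialIsometry g (quotientMetric g hg) (quotSection G x).symm := by
  have h : ((quotSection G x).symm : M → orbitRel.Quotient G M) = quotProj G M :=
    funext (quotSection_symm_apply x)
  refine ⟨?_, contMDiffOn_quotSection x, fun z _ => ?_⟩
  · rw [h]
    exact contMDiff_quotProj.contMDiffOn
  · rw [h]
    exact quotientMetric_quotProj g hg z

theorem measureScaling_quotProj_volume : MeasureScaling (quotProj G M) (Fintype.card G)
    (riemannianVolume g) (riemannianVolume (quotientMetric g hg)) := by
  let _ : MeasurableSpace M := borel M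
  have : BorelSpace M := ⟨rfl⟩
  let _ : MeasurableSpace (orbitRel.Quotient G M) := borel _
  have : BorelSpace (orbitRel.Quotient G M) := ⟨rfl⟩
  refine measureScaling_quotProj (fun a s hs => ?_) fun x s hs => ?_
  · have h := (measureScaling_smul_volume (hg a)).map_eq
    rw [ENNReal.ofReal_one, one_smul] at h
    rw [← Measure.map_apply (continuous_const_smul a).measurable hs, h]
  · have h := (isPartialIsometry_quotSection_symm hg x).riemannianVolume_preimage hs
    rwa [show ((quotSection G x).symm : M → orbitRel.Quotient G M) = quotProj G M from
      funext (quotSection_symm_apply x)] at h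

theorem measureScaling_quotProj_boundary : MeasureScaling (quotProj G M) (Fintype.card G)
    (boundaryMeasure g) (boundaryMeasure (quotientMetric g hg)) := by
  let _ : MeasurableSpace M := borel M
  have : BorelSpace M := ⟨rfl⟩
  let _ : MeasurableSpace (orbitRel.Quotient G M) := borel _
  have : BorelSpace (orbitRel.Quotient G M) := ⟨rfl⟩
  refine measureScaling_quotProj (fun a s hs => ?_) fun x s hs => ?_
  · have h := (measureScaling_smul_boundary (hg a)).map_eq
    rw [ENNReal.ofReal_one, one_smul] at h
    rw [← Measure.map_apply (continuous_const_smul a).measurable hs, h]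
  · have h := (isPartialIsometry_quotSection_symm hg x).boundaryMeasure_preimage hs
    rwa [show ((quotSection G x).symm : M → orbitRel.Quotient G M) = quotProj G M from
      funext (quotSection_symm_apply x)] at h

theorem contMDiff_inducedFunction {f : M → ℝ} (hf : ContMDiff (𝓡∂ (d + 1)) 𝓘(ℝ, ℝ) ∞ f) :
    ContMDiff (𝓡∂ (d + 1)) 𝓘(ℝ, ℝ) ∞ (inducedFunction G f) := by
  intro q
  have h1 : ContMDiff (𝓡∂ (d + 1)) 𝓘(ℝ, ℝ) ∞ fun x => inducedFunction G f (quotProj G M x) := by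
    simp only [inducedFunction_quotProj_eq_sum]
    exact contMDiff_const.mul (contMDiff_finsetSum fun a _ =>
      hf.comp (ContMDiffConstSMul.contMDiff_const_smul a))
  have hq := mem_quotSection_out q
  refine (h1.contMDiffAt.comp q (contMDiffAt_quotSection hq)).congr_of_eventuallyEq ?_
  filter_upwards [(quotSection G q.out).open_source.mem_nhds hq] with z hz
  simp only [Function.comp_apply, quotProj_quotSection hz]

variable (d M G) in
/-- The average over orbits, as a map from smooth functions to smooth functions on the quotient. -/
def averageSmooth : C^∞⟮𝓡∂ (d + 1), M; 𝓘(ℝ, ℝ), ℝ⟯ →ₗ[ℝ]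
    C^∞⟮𝓡∂ (d + 1), orbitRel.Quotient G M; 𝓘(ℝ, ℝ), ℝ⟯ where
  toFun f := ⟨inducedFunction G f, contMDiff_inducedFunction f.contMDiff⟩
  map_add' f f' := by
    ext q
    obtain ⟨x, rfl⟩ := Quotient.mk_surjective (s := orbitRel G M) q
    change inducedFunction G _ (quotProj G M x) = inducedFunction G _ (quotProj G M x) +
      inducedFunction G _ (quotProj G M x)
    simp only [inducedFunction_quotProj_eq_sum, ← mul_add, ← Finset.sum_add_distrib]
    rfl
  map_smul' c f := by
    ext q
    obtain ⟨x, rfl⟩ := Quotient.mk_surjective (s := orbitRel G M) q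
    change inducedFunction G _ (quotProj G M x) = c * inducedFunction G _ (quotProj G M x)
    simp only [inducedFunction_quotProj_eq_sum]
    rw [mul_left_comm, Finset.mul_sum (a := c)]
    rfl

theorem averageSmooth_apply (f : C^∞⟮𝓡∂ (d + 1), M; 𝓘(ℝ, ℝ), ℝ⟯) (q : orbitRel.Quotient G M) :
    averageSmooth d M G f q = inducedFunction G f q := rfl

theorem averageSmooth_compSmooth (φ : C^∞⟮𝓡∂ (d + 1), orbitRel.Quotient G M; 𝓘(ℝ, ℝ), ℝ⟯) :
    averageSmooth d M G (compSmooth contMDiff_quotProj φ) = φ :=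
  ContMDiffMap.ext fun q => congrFun (inducedFunction_comp_quotProj (G := G) φ) q

theorem compSmooth_averageSmooth (ψ : C^∞⟮𝓡∂ (d + 1), M; 𝓘(ℝ, ℝ), ℝ⟯) :
    compSmooth contMDiff_quotProj (averageSmooth d M G ψ) = (Fintype.card G : ℝ)⁻¹ •
      ∑ a : G, compSmooth (ContMDiffConstSMul.contMDiff_const_smul a) ψ := by
  ext x
  have h := map_sum (ContMDiffMap.coeFnAddMonoidHom (I := 𝓡∂ (d + 1)) (I' := 𝓘(ℝ, ℝ)) (N := M)
    (G := ℝ) (n := ∞)) (fun a : G => compSmooth (ContMDiffConstSMul.contMDiff_const_smul a) ψ)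
    Finset.univ
  rw [ContMDiffMap.coe_smul, Pi.smul_apply, smul_eq_mul, compSmooth_apply, averageSmooth_apply,
    inducedFunction_quotProj_eq_sum]
  refine congrArg _ (Eq.trans ?_ (congrFun h x).symm)
  rw [Finset.sum_apply]
  rfl

/-- The energy on the quotient is adjoint to that on `M`: the energy of an invariant function and
`ψ` does not change if `ψ` is replaced by a translate of it, hence by its average. -/
theorem dirichletForm_compSmooth_quotProj
    (φ : C^∞⟮𝓡∂ (d + 1), orbitRel.Quotient G M; 𝓘(ℝ, ℝ), ℝ⟯)
    (ψ : C^∞⟮𝓡∂ (d + 1), M; 𝓘(ℝ, ℝ), ℝ⟯) :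
    dirichletForm g (compSmooth contMDiff_quotProj φ) ψ =
      Fintype.card G * dirichletForm (quotientMetric g hg) φ (averageSmooth d M G ψ) := by
  have h1 := (measureScaling_quotProj_volume hg).integral_comp
    (integrable_energyDensity (quotientMetric g hg) φ (averageSmooth d M G ψ)).1
  have h2 : ∀ x, energyDensity (quotientMetric g hg) φ (averageSmooth d M G ψ) (quotProj G M x) =
      energyDensity g (compSmooth contMDiff_quotProj φ)
        (compSmooth contMDiff_quotProj (averageSmooth d M G ψ)) x := fun x =>
    (energyDensity_compSmooth contMDiff_quotProj (quotientMetric_quotProj g hg) _ _ x).symm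
  have h3 : ∀ a : G, dirichletForm g (compSmooth contMDiff_quotProj φ)
      (compSmooth (ContMDiffConstSMul.contMDiff_const_smul a) ψ) =
      dirichletForm g (compSmooth contMDiff_quotProj φ) ψ := by
    intro a
    have h := PreservesMetric.dirichletForm_comp (F := smulDiffeomorph d M a) (hg a)
      (compSmooth contMDiff_quotProj φ) ψ
    have h4 : compSmooth (smulDiffeomorph d M a).contMDiff_toFun
        (compSmooth contMDiff_quotProj φ) = compSmooth (contMDiff_quotProj (G := G)) φ :=
      ContMDiffMap.ext fun x => congrArg φ (quotProj_smul a x)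
    rw [h4] at h
    exact h
  simp only [h2] at h1
  rw [dirichletForm_eq, dirichletForm_eq, ← h1, ← dirichletForm_eq, ← dirichletForm_eq]
  let S := weakSteklov g (MemLp.zero (ε := ℝ) (p := ⊤) (μ := boundaryMeasure g))
  have h5 : ∀ a : G, S.energy (compSmooth contMDiff_quotProj φ)
      (compSmooth (ContMDiffConstSMul.contMDiff_const_smul a) ψ) =
      S.energy (compSmooth contMDiff_quotProj φ) ψ := h3
  change S.energy (compSmooth contMDiff_quotProj φ) ψ = S.energy (compSmooth contMDiff_quotProj φ)
    (compSmooth contMDiff_quotProj (averageSmooth d M G ψ))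
  rw [compSmooth_averageSmooth, map_smul, map_sum, Finset.sum_congr rfl fun a _ => h5 a,
    Finset.sum_const,
    Finset.card_univ, ← Nat.cast_smul_eq_nsmul ℝ, smul_smul,
    inv_mul_cancel₀ (by exact_mod_cast Fintype.card_ne_zero), one_smul]

variable {ρ : M → ℝ}

theorem memLp_top_inducedFunction (hρ : MemLp ρ ⊤ (boundaryMeasure g)) :
    MemLp (inducedFunction G ρ) ⊤ (boundaryMeasure (quotientMetric g hg)) := by
  let _ : MeasurableSpace M := borel M
  have : BorelSpace M := ⟨rfl⟩
  let _ : MeasurableSpace (orbitRel.Quotient G M) := borel _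
  have : BorelSpace (orbitRel.Quotient G M) := ⟨rfl⟩
  exact (measureScaling_quotProj_boundary hg).memLp_inducedFunction
    (fun a => measureScaling_smul_boundary (hg a)) hρ

/-- Composition with the projection and average over orbits exchange the solutions on the quotient
and the solutions on `M`. -/
theorem solutions_quotient (hρ : MemLp ρ ⊤ (boundaryMeasure g))
    (hρG : ∀ a : G, ∀ᵐ x ∂boundaryMeasure g, ρ (a • x) = ρ x) (α σ : ℝ) :
    (∀ u ∈ (weakSteklov (quotientMetric g hg) (memLp_top_inducedFunction hg hρ)).solutions α σ,
      (measureScaling_quotProj_volume hg).pullback u ∈ (weakSteklov g hρ).solutions α σ) ∧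
    ∀ u ∈ (weakSteklov g hρ).solutions α σ, (measureScaling_quotProj_volume hg).pushforward u ∈
      (weakSteklov (quotientMetric g hg) (memLp_top_inducedFunction hg hρ)).solutions α σ := by
  let _ : MeasurableSpace M := borel M
  have : BorelSpace M := ⟨rfl⟩
  let _ : MeasurableSpace (orbitRel.Quotient G M) := borel _
  have : BorelSpace (orbitRel.Quotient G M) := ⟨rfl⟩
  have hv := measureScaling_quotProj_volume hg
  have hb := measureScaling_quotProj_boundary hg
  have hUv := fun a => measureScaling_smul_volume (hg a)
  have hUb := fun a => measureScaling_smul_boundary (hg a)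
  have hρinv := MeasureScaling.inducedFunction_quotProj_ae_eq hρG
  refine WeakProblem.solutions_of_adjoint (PC := compSmooth contMDiff_quotProj)
    (QC := averageSmooth d M G) (PY := hb.pullback) (QY := hb.pushforward)
    (c := Fintype.card G) (by exact_mod_cast Fintype.card_pos) averageSmooth_compSmooth
    (fun φ => pullback_incl _ _ _ φ _) (fun ψ => ?_) (fun φ => pullback_trace _ _ _ φ _)
    (fun ψ => ?_) (fun φ => pullback_weight _ _ _ φ _ hρinv) (fun ψ => ?_) hv.inner_pullback_left
    hb.inner_pullback_left dirichletForm_comm dirichletForm_comm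
    (dirichletForm_compSmooth_quotProj hg)
  · exact hv.pushforward_toLp hUv (memLp_riemannianVolume g ψ.contMDiff.continuous 2)
  · exact hb.pushforward_toLp hUb (memLp_boundaryMeasure g ψ.contMDiff.continuous 2)
  · refine (hb.pushforward_toLp hUb
      (memLp_mul_boundaryMeasure g hρ ψ.contMDiff.continuous)).trans ?_
    refine MemLp.toLp_congr _ (memLp_mul_boundaryMeasure _ (memLp_top_inducedFunction hg hρ)
      (averageSmooth d M G ψ).contMDiff.continuous) (hb.ae_eq_of_comp_quotProj hUb ?_)
    filter_upwards [ae_all_iff.2 hρG, hρinv] with x hx hx'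
    rw [hx', averageSmooth_apply]
    simp only [inducedFunction_quotProj_eq_sum, hx, ← Finset.mul_sum]
    exact mul_left_comm _ _ _

end Covering

/-! ### Transplantation -/

universe v in
theorem rank_eq_of_bijOn {X Y : Type v} [AddCommGroup X] [Module ℝ X]
    [AddCommGroup Y] [Module ℝ Y] {f : X →ₗ[ℝ] Y} (hf : Function.Injective f) {U : Submodule ℝ X}
    {W : Submodule ℝ Y} (h1 : ∀ u ∈ U, f u ∈ W) (h2 : ∀ w ∈ W, ∃ u ∈ U, f u = w) :
    Module.rank ℝ U = Module.rank ℝ W := by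
  have h : U.map f = W := le_antisymm (Submodule.map_le_iff_le_comap.2 h1) h2
  rw [← h]
  exact (Submodule.equivMapOfInjective f hf U).rank_eq

section Invariants

variable {d : ℕ} {M : Type*} [TopologicalSpace M] [CompactSpace M] [T2Space M]
  [ChartedSpace (EuclideanHalfSpace (d + 1)) M] [IsManifold (𝓡∂ (d + 1)) ∞ M]
  {g : RiemannianMetricOn (𝓡∂ (d + 1)) M} {G : Type*} [Group G] [MulAction G M]
  [ContinuousConstSMul G M] [ContMDiffConstSMul (𝓡∂ (d + 1)) G M]
  (hG : ∀ a : G, PreservesMetric g (fun x : M => a • x))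

/-- The representation of a group of isometries on `L²(M)`, with `a` acting by composition with
`a⁻¹`. -/
def isometryRepresentation : Representation ℝ G (Lp ℝ 2 (riemannianVolume g)) where
  toFun a := (measureScaling_smul_volume (hG a⁻¹)).pullback.toLinearMap
  map_one' := LinearMap.ext fun f =>
    MeasureScaling.pullback_eq_self _ (fun x => by rw [inv_one, one_smul]) f
  map_mul' a b := LinearMap.ext fun f =>
    (MeasureScaling.pullback_pullback (measureScaling_smul_volume (hG a⁻¹))
      (measureScaling_smul_volume (hG b⁻¹)) (measureScaling_smul_volume (hG (a * b)⁻¹))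
      (fun x => by rw [mul_inv_rev, mul_smul]) f).symm

theorem mem_invariantsOf_isometryRepresentation {K : Subgroup G}
    {u : Lp ℝ 2 (riemannianVolume g)} : u ∈ invariantsOf (isometryRepresentation hG) K ↔
      ∀ a : K, (measureScaling_smul_volume (hG a)).pullback u = u := by
  rw [Representation.mem_invariants]
  constructor
  · intro h a
    have h1 := h a⁻¹
    change (measureScaling_smul_volume (hG ((a⁻¹ : K) : G)⁻¹)).pullback u = u at h1
    simpa only [InvMemClass.coe_inv, inv_inv] using h1
  · intro h a
    exact h a⁻¹

variable {ρ : M → ℝ} (hρ : MemLp ρ ⊤ (boundaryMeasure g))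

theorem solutions_le_comap_isometryRepresentation
    (hρG : ∀ a : G, ∀ᵐ x ∂boundaryMeasure g, ρ (a • x) = ρ x) (α σ : ℝ) (a : G) :
    (weakSteklov g hρ).solutions α σ ≤
      ((weakSteklov g hρ).solutions α σ).comap (isometryRepresentation hG a) := fun _ hu =>
  PreservesMetric.pullback_mem_solutions (F := smulDiffeomorph d M a⁻¹) (hG a⁻¹) (hρG a⁻¹) hu

/-- The solutions on `K \ M` are the `K`-invariant solutions on `M`. -/
theorem rank_solutions_quotient (K : Subgroup G) [Fintype K] [IsCancelSMul K M]
    (hρK : ∀ a : K, ∀ᵐ x ∂boundaryMeasure g, ρ (a • x) = ρ x) (α σ : ℝ) :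
    Module.rank ℝ ((weakSteklov (quotientMetric g fun a : K => hG a)
      (memLp_top_inducedFunction (fun a : K => hG a) hρ)).solutions α σ) =
    Module.rank ℝ ↥((weakSteklov g hρ).solutions α σ ⊓
      invariantsOf (isometryRepresentation hG) K) := by
  let _ : MeasurableSpace M := borel M
  have : BorelSpace M := ⟨rfl⟩
  let _ : MeasurableSpace (orbitRel.Quotient K M) := borel _
  have : BorelSpace (orbitRel.Quotient K M) := ⟨rfl⟩
  have hv := measureScaling_quotProj_volume fun a : K => hG a
  have hU := fun a : K => measureScaling_smul_volume (hG a)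
  have hs := solutions_quotient (fun a : K => hG a) hρ hρK α σ
  refine rank_eq_of_bijOn (f := hv.pullback.toLinearMap) hv.pullback_injective
    (fun u hu => ⟨hs.1 u hu, (mem_invariantsOf_isometryRepresentation hG).2 fun a =>
      hv.pullback_smul_pullback_quotProj hU a u⟩)
    fun w hw => ⟨hv.pushforward w, hs.2 w hw.1, ?_⟩
  exact hv.pullback_pushforward_of_invariant hU
    ((mem_invariantsOf_isometryRepresentation hG).1 hw.2)

variable {H H' : Subgroup G} {F : M ≃ₘ^∞⟮𝓡∂ (d + 1), 𝓡∂ (d + 1)⟯ M}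

theorem PreservesMetric.memLp_top_comp (hF : PreservesMetric g F)
    (hρ : MemLp ρ ⊤ (boundaryMeasure g)) :
    MemLp (ρ ∘ F) ⊤ (boundaryMeasure g) :=
  (hF.measureScaling_boundary.memLp_comp_iff hρ.1).2 hρ

/-- If the isometry `F` conjugates `H` into `H'`, then composition with `F` maps `H'`-invariant
solutions to `H`-invariant ones. -/
theorem PreservesMetric.pullback_mem_inf_invariantsOf (hF : PreservesMetric g F) {ρ' : M → ℝ}
    {hρ : MemLp ρ ⊤ (boundaryMeasure g)} {hρ' : MemLp ρ' ⊤ (boundaryMeasure g)}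
    (hρρ' : ∀ᵐ x ∂boundaryMeasure g, ρ (F x) = ρ' x)
    (hH : ∀ a : H, ∃ b : H', ∀ x : M, b • F x = F (a • x)) {α σ : ℝ}
    {u : Lp ℝ 2 (riemannianVolume g)} (hu : u ∈ (weakSteklov g hρ).solutions α σ ⊓
      invariantsOf (isometryRepresentation hG) H') :
    hF.measureScaling_volume.pullback u ∈ (weakSteklov g hρ').solutions α σ ⊓
      invariantsOf (isometryRepresentation hG) H := by
  refine ⟨hF.pullback_mem_solutions hρρ' hu.1,
    (mem_invariantsOf_isometryRepresentation hG).2 fun a => ?_⟩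
  obtain ⟨b, hb⟩ := hH a
  have hv := hF.measureScaling_volume
  have ha := measureScaling_smul_volume (hG a)
  have hinv := (mem_invariantsOf_isometryRepresentation hG).1 hu.2 b
  have h1 := hv.pullback_pullback (measureScaling_smul_volume (hG b)) (ha.comp hv) hb u
  rw [hinv] at h1
  exact (ha.pullback_pullback hv (ha.comp hv) (fun _ => rfl) u).trans h1.symm

/-- If `F` conjugates `H` to `H'`, then composition with `F` maps the `H'`-invariant solutions with
density `ρ` onto the `H`-invariant solutions with density `ρ ∘ F`. -/
theorem PreservesMetric.rank_inf_invariantsOf_comp (hF : PreservesMetric g F)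
    (hH : range (fun (h : H) (x : M) => F (h • F.symm x)) = range fun (h : H') (x : M) => h • x)
    (α σ : ℝ) :
    Module.rank ℝ ↥((weakSteklov g hρ).solutions α σ ⊓
      invariantsOf (isometryRepresentation hG) H') =
    Module.rank ℝ ↥((weakSteklov g (hF.memLp_top_comp hρ)).solutions α σ ⊓
      invariantsOf (isometryRepresentation hG) H) := by
  have h1 : ∀ a : H, ∃ b : H', ∀ x : M, b • F x = F (a • x) := by
    intro a
    obtain ⟨b, hb⟩ : (fun x : M => F (a • F.symm x)) ∈ range fun (h : H') (x : M) => h • x :=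
      hH ▸ mem_range_self a
    exact ⟨b, fun x => (congrFun hb (F x)).trans
      (congrArg (fun y => F (a • y)) (F.symm_apply_apply x))⟩
  have h2 : ∀ b : H', ∃ a : H, ∀ x : M, a • F.symm x = F.symm (b • x) := by
    intro b
    obtain ⟨a, ha⟩ : (fun x : M => b • x) ∈ range fun (h : H) (x : M) => F (h • F.symm x) :=
      hH ▸ mem_range_self b
    exact ⟨a, fun x => (F.symm_apply_apply _).symm.trans (congrArg F.symm (congrFun ha x))⟩
  have h3 : ∀ᵐ x ∂boundaryMeasure g, (ρ ∘ F) (F.symm x) = ρ x :=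
    Eventually.of_forall fun x => congrArg ρ (F.apply_symm_apply x)
  have hv := hF.measureScaling_volume
  have hv' := hF.symm.measureScaling_volume
  refine rank_eq_of_bijOn (f := hv.pullback.toLinearMap) hv.pullback_injective
    (fun u hu => hF.pullback_mem_inf_invariantsOf hG (Eventually.of_forall fun x => rfl) h1 hu)
    fun w hw => ⟨hv'.pullback w, hF.symm.pullback_mem_inf_invariantsOf hG h3 h2 hw, ?_⟩
  exact (hv.pullback_pullback hv' (hv.comp hv') (fun _ => rfl) w).trans
    ((hv.comp hv').pullback_eq_self F.symm_apply_apply w)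

end Invariants

end Steklov

end

theorem mainTheorem4 {d : ℕ} {M : Type*} [TopologicalSpace M] [CompactSpace M] [T2Space M]
    [ChartedSpace (EuclideanHalfSpace (d + 1)) M] [IsManifold (𝓡∂ (d + 1)) ∞ M]
    -- the Riemannian metric
    (g : RiemannianMetricOn (𝓡∂ (d + 1)) M)
    -- the finite group `G` acts on `M` by isometries
    {G : Type*} [Group G] [Finite G] [MulAction G M] [ContinuousConstSMul G M]
    [ContMDiffConstSMul (𝓡∂ (d + 1)) G M]
    (hG : ∀ a : G, PreservesMetric g (fun x : M => a • x))
    -- the almost conjugate subgroups act freely (`IsCancelSMul`)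
    (H H' : Subgroup G) (hHH' : AlmostConjugate H H')
    [IsCancelSMul H M] [IsCancelSMul H' M]
    -- the density: bounded, nonnegative and `G`-invariant on the boundary of `M`
    (ρ : M → ℝ) (hρ : MemLp ρ ⊤ (boundaryMeasure g)) (hρ0 : ∀ᵐ x ∂boundaryMeasure g, 0 ≤ ρ x)
    (hρG : ∀ a : G, ∀ᵐ x ∂boundaryMeasure g, ρ (a • x) = ρ x)
    -- the isometry `τ`, which is not in `G` and satisfies `τ H τ⁻¹ = H'`
    (τ : M ≃ₘ^∞⟮𝓡∂ (d + 1), 𝓡∂ (d + 1)⟯ M) (hτ : PreservesMetric g τ)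
    (hτG : ∀ a : G, ∃ x : M, τ x ≠ a • x)
    (hτH : range (fun (h : H) (x : M) => τ (h • τ.symm x)) = range fun (h : H') (x : M) => h • x)
    (α : ℝ) (hα : α ∉ dirichletSpectrum (quotientMetric g fun a : H => hG a)) :
    steklovSpectrum (quotientMetric g fun a : H => hG a) α (inducedFunction H ρ) =
      steklovSpectrum (quotientMetric g fun a : H => hG a) α (inducedFunction H (ρ ∘ τ)) ∧
    ∀ σ : ℝ,
      steklovMultiplicity (quotientMetric g fun a : H => hG a) α (inducedFunction H ρ) σ =
        steklovMultiplicity (quotientMetric g fun a : H => hG a) α (inducedFunction H (ρ ∘ τ)) σ := by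
  have := Fintype.ofFinite H
  -- `ρ ∘ τ` is `H`-invariant because `ρ` is `H'`-invariant
  have hρτ : ∀ a : H, ∀ᵐ x ∂boundaryMeasure g, (ρ ∘ τ) (a • x) = (ρ ∘ τ) x := by
    intro a
    obtain ⟨b, hb⟩ : (fun x : M => τ (a • τ.symm x)) ∈ range fun (h : H') (x : M) => h • x :=
      hτH ▸ mem_range_self a
    filter_upwards [hτ.measureScaling_boundary.quasiMeasurePreserving.ae (hρG b)] with x hx
    refine Eq.trans (congrArg ρ ?_) hx
    exact ((congrFun hb (τ x)).trans
      (congrArg (fun y => τ (a • y)) (τ.symm_apply_apply x))).symm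
  have key : ∀ σ : ℝ,
      Module.rank ℝ ((weakSteklov (quotientMetric g fun a : H => hG a)
        (memLp_top_inducedFunction (fun a : H => hG a) hρ)).solutions α σ) =
      Module.rank ℝ ((weakSteklov (quotientMetric g fun a : H => hG a)
        (memLp_top_inducedFunction (fun a : H => hG a) (hτ.memLp_top_comp hρ))).solutions α σ) := by
    intro σ
    rw [rank_solutions_quotient hG hρ H (fun a => hρG a) α σ,
      rank_solutions_quotient hG (hτ.memLp_top_comp hρ) H hρτ α σ,
      hHH'.rank_inf_invariantsOf (isometryRepresentation hG) _
        (solutions_le_comap_isometryRepresentation hG hρ hρG α σ),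
      hτ.rank_inf_invariantsOf_comp hG hρ hτH α σ]
  refine ⟨Set.ext fun σ => ?_, fun σ => ?_⟩
  · rw [mem_steklovSpectrum_iff _ (memLp_top_inducedFunction (fun a : H => hG a) hρ),
      mem_steklovSpectrum_iff _
        (memLp_top_inducedFunction (fun a : H => hG a) (hτ.memLp_top_comp hρ)), key]
  · rw [steklovMultiplicity_eq_rank _ (memLp_top_inducedFunction (fun a : H => hG a) hρ),
      steklovMultiplicity_eq_rank _
        (memLp_top_inducedFunction (fun a : H => hG a) (hτ.memLp_top_comp hρ)), key]
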